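/- **Setting.** Let $(M,g)$ be a smooth Lorentzian manifold of dimension $m$, signature $(-,+,\dots,+)$, with Levi-Civita connection $\nabla$. Let $\Phi\colon M\to\mathbb R$ be smooth with nowhere null gradient, and let $M$ be foliated by the slices $S_s=\{\Phi=s\}$. Put $\varphi=\|\nabla\Phi\|^{-1}$, $n_\alpha=\pm\varphi\nabla_\alpha\Phi$, $n^\alpha n_\alpha=\epsilon$ ($\epsilon=1$ for timelike slices, $\epsilon=-1$ for spacelike slices), $h_{\alpha\beta}=g_{\alpha\beta}-\epsilon n_\alpha n_\beta$, $\chi_{\alpha\beta}=h^\lambda_\alpha h^\rho_\beta\nabla_\lambda n_\rho$, and let $\mathcal D$ be the tangential derivative, obtained by projecting $\nabla$ with $h$ (so $\mathcal D_\gamma f=h^\lambda_\gamma\nabla_\lambda f$ on functions). Symmetrization $T_{(\alpha\beta\dots)}$ is the sum over permutations. Let $\mathcal K_a{}^\alpha$, $a=1,\dots,n$, $n\le m-2$, be smooth Killing vector fields tangent to all slices, whose Gram matrix $\mathcal G_{ab}=\mathcal K_a{}^\alpha\mathcal K_{b\alpha}$ is invertible everywhere, with inverse $\mathcal G^{ab}$.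 At each point let $\mathcal X$ be the $(m-n-1)$-dimensional space of vectors tangent to the slice and orthogonal to all $\mathcal K_a$, and set $$\chi=\frac{1}{m-n-1}\left(h^{\alpha\beta}\chi_{\alpha\beta}-\mathcal G^{ab}\chi_{\alpha\beta}\mathcal K_a{}^\alpha\mathcal K_b{}^\beta\right),$$ which is $\frac1{m-n-1}$ times the trace of the second fundamental form over $\mathcal X$. **Hypotheses.** For all $X,Y\in\mathcal X$ and all $a$, $$\chi_{\alpha\beta}\mathcal K_a{}^\alpha X^\beta=0,\qquad \chi_{\alpha\beta}X^\alpha Y^\beta=\chi\,h_{\alpha\beta}X^\alpha Y^\beta;$$ everywhere on $M$, $$\mathcal D_\gamma\left(\varphi\chi-\varphi\,n^\alpha\nabla_\alpha\ln\varphi\right)=0,\qquad \mathcal D_\gamma(\chi\varphi^3)=0;$$ at every point where $\chi\ne0$, $$\mathcal D_\gamma\left(\mathcal G^{ab}+\frac1{2\chi}n^\alpha\nabla_\alpha\mathcal G^{ab}\right)=0;$$ and at every point where $\chi=0$, $$\mathcal D_\gamma\left(n^\alpha\nabla_\alpha\mathcal G^{ab}\right)=-\mathcal D_\gamma\ln\varphi^3\cdot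 n^\alpha\nabla_\alpha\mathcal G^{ab}.$$ **The equations.** For an open set $U\subseteq M$ consider the following system for smooth functions $\tilde\Psi$, $\alpha$, $\gamma^{ab}=\gamma^{ba}$, $\nu^{ab}$ on $U$, where $\Psi=\ln\varphi^2+\tilde\Psi$: $$n^\alpha\nabla_\alpha\tilde\Psi=2\left(\chi-n^\alpha\nabla_\alpha\ln\varphi\right),\quad \mathcal D_\tau\tilde\Psi=0,$$ $$n^\beta\nabla_\beta\alpha=-2\epsilon\chi e^\Psi,\quad \mathcal D_\tau\alpha=0,$$ $$\gamma^{ab}=\epsilon e^\Psi\mathcal G^{ab}+\nu^{ab},\quad n^\alpha\nabla_\alpha\nu^{ab}=0,\quad \mathcal D_\tau\gamma^{ab}=0.$$ **Conclusion.** 1. For every solution of this system on an open set $U$, the tensor $$K_{\alpha\beta}=\alpha g_{\alpha\beta}+\gamma^{ab}\mathcal K_{a\alpha}\mathcal K_{b\beta}+e^\Psi n_\alpha n_\beta$$ is a Killing tensor on $U$, that is, smooth and symmetric with $\nabla_{(\alpha}K_{\beta\gamma)}=0$. It is slice-reducible with respect to the given foliation: its projection to the slices has the form $a\,h_{\alpha\beta}+c^{ij}L_{i\alpha}L_{j\beta}$,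 where the $L_i$ are finitely many smooth vector fields tangent to the slices and Killing in them ($\mathcal D_{(\alpha}L_{i\beta)}=0$), $a$ and the symmetric $c^{ij}$ are smooth, and $\mathcal D_\tau a=0$, $\mathcal D_\tau c^{ij}=0$. 2. The system has a solution on $M$ if all slices are connected, and more generally on every open $U$ for which all the sets $U\cap S_s$ are connected or empty. 3. Without any connectedness assumption, every point of $M$ has an open neighbourhood on which the system has a solution. -/

import Mathlib

open scoped Manifold ContDiff Bundle
open Set

noncomputable section

namespace SliceKT

variable {m : ℕ} {M : Type*} [TopologicalSpace M] [ChartedSpace (EuclideanSpace ℝ (Fin m)) M]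
  [IsManifold (𝓡 m) ∞ M]

/-! ## Lorentzian metrics -/

variable (m M) in
/-- A smooth Lorentzian metric (signature `(-,+,…,+)`) on an `m`-dimensional manifold. -/
structure LorentzianMetric where
  /-- the metric at each point -/
  val (x : M) : TangentSpace (𝓡 m) x →L[ℝ] TangentSpace (𝓡 m) x →L[ℝ] ℝ
  symm (x : M) (v w : TangentSpace (𝓡 m) x) : val x v w = val x w v
  lorentzian (x : M) : ∃ (b : Module.Basis (Fin m) ℝ (TangentSpace (𝓡 m) x)) (i₀ : Fin m),
    ∀ i j, val x (b i) (b j) = if i = j then (if i = i₀ then -1 else 1) else 0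
  contMDiff : ContMDiff (𝓡 m)
    ((𝓡 m).prod 𝓘(ℝ, EuclideanSpace ℝ (Fin m) →L[ℝ] EuclideanSpace ℝ (Fin m) →L[ℝ] ℝ)) ∞
    (fun x ↦ Bundle.TotalSpace.mk'
      (EuclideanSpace ℝ (Fin m) →L[ℝ] EuclideanSpace ℝ (Fin m) →L[ℝ] ℝ) x (val x))

instance : CoeFun (LorentzianMetric m M)
    (fun _ ↦ (x : M) → TangentSpace (𝓡 m) x →L[ℝ] TangentSpace (𝓡 m) x →L[ℝ] ℝ) :=
  ⟨LorentzianMetric.val⟩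

theorem LorentzianMetric.eq_zero_of_forall (g : LorentzianMetric m M) (x : M)
    (v : TangentSpace (𝓡 m) x) (h : ∀ w, g x v w = 0) : v = 0 := by
  obtain ⟨b, i₀, hb⟩ := g.lorentzian x
  have key : ∀ j, b.repr v j = 0 := by
    intro j
    have h1 := h (b j)
    rw [← b.sum_repr v] at h1
    simp only [map_sum, map_smul, FunLike.coe_sum, FunLike.coe_smul,
      Finset.sum_apply, Pi.smul_apply, smul_eq_mul, hb] at h1
    simp only [mul_ite, mul_zero, Finset.sum_ite_eq', Finset.mem_univ, if_true] at h1
    split_ifs at h1 <;> linarith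
  rw [← b.sum_repr v]
  simp [key]

instance instFinDimTangent (x : M) : FiniteDimensional ℝ (TangentSpace (𝓡 m) x) :=
  inferInstanceAs (FiniteDimensional ℝ (EuclideanSpace ℝ (Fin m)))

/-- The metric at a point as a bilinear form. -/
def LorentzianMetric.form (g : LorentzianMetric m M) (x : M) :
    LinearMap.BilinForm ℝ (TangentSpace (𝓡 m) x) :=
  LinearMap.mk₂ ℝ (fun v w ↦ g x v w) (by simp) (by simp) (by simp) (by simp)

theorem LorentzianMetric.form_nondegenerate (g : LorentzianMetric m M) (x : M) :
    (g.form x).Nondegenerate := by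
  constructor
  · intro v h
    exact g.eq_zero_of_forall x v h
  · intro v h
    refine g.eq_zero_of_forall x v fun w ↦ ?_
    rw [g.symm]
    exact h w

/-- Raising an index: `sharp g x L` is the vector `w` with `g(w, z) = L z` for all `z`. -/
def sharp (g : LorentzianMetric m M) (x : M) :
    (TangentSpace (𝓡 m) x →L[ℝ] ℝ) →ₗ[ℝ] TangentSpace (𝓡 m) x :=
  ((g.form x).toDual (g.form_nondegenerate x)).symm.toLinearMap ∘ₗ
    ContinuousLinearMap.coeLM ℝ

theorem sharp_spec (g : LorentzianMetric m M) (x : M) (L : TangentSpace (𝓡 m) x →L[ℝ] ℝ)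
    (z : TangentSpace (𝓡 m) x) : g x (sharp g x L) z = L z := by
  have := LinearMap.BilinForm.apply_toDual_symm_apply (hB := g.form_nondegenerate x)
    (L : Module.Dual ℝ (TangentSpace (𝓡 m) x)) z
  exact this


/-! ## The Levi-Civita connection, from the Koszul formula -/

/-- Differentiability of a vector field at a point. -/
abbrev DiffFieldAt (X : (y : M) → TangentSpace (𝓡 m) y) (x : M) : Prop :=
  MDifferentiableAt (𝓡 m) ((𝓡 m).prod 𝓘(ℝ, EuclideanSpace ℝ (Fin m)))
    (fun y ↦ Bundle.TotalSpace.mk' (EuclideanSpace ℝ (Fin m)) y (X y)) x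

theorem mdifferentiableAt_metric (g : LorentzianMetric m M) {x : M}
    {Y Z : (y : M) → TangentSpace (𝓡 m) y} (hY : DiffFieldAt Y x) (hZ : DiffFieldAt Z x) :
    MDifferentiableAt (𝓡 m) 𝓘(ℝ, ℝ) (fun y ↦ g y (Y y) (Z y)) x := by
  have hg : MDifferentiableAt (𝓡 m)
      ((𝓡 m).prod 𝓘(ℝ, EuclideanSpace ℝ (Fin m) →L[ℝ] EuclideanSpace ℝ (Fin m) →L[ℝ] ℝ))
      (fun x ↦ Bundle.TotalSpace.mk'
        (EuclideanSpace ℝ (Fin m) →L[ℝ] EuclideanSpace ℝ (Fin m) →L[ℝ] ℝ)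
        (E := fun x ↦ TangentSpace (𝓡 m) x →L[ℝ] TangentSpace (𝓡 m) x →L[ℝ] ℝ) x (g x)) x :=
    (g.contMDiff x).mdifferentiableAt (by simp)
  have : MDifferentiableAt (𝓡 m) ((𝓡 m).prod 𝓘(ℝ))
      (fun y ↦ Bundle.TotalSpace.mk' ℝ (E := Bundle.Trivial M ℝ) y (g y (Y y) (Z y))) x :=
    MDifferentiableAt.clm_bundle_apply₂ (F₁ := EuclideanSpace ℝ (Fin m))
      (F₂ := EuclideanSpace ℝ (Fin m)) hg hY hZ
  simp only [mdifferentiableAt_totalSpace] at this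
  exact this.2

/-- The right-hand side of the Koszul formula, which equals `2 g(∇_X Y, Z)`. -/
def koszul (g : LorentzianMetric m M) (X Y Z : (y : M) → TangentSpace (𝓡 m) y) (x : M) : ℝ :=
  mvfderiv (𝓡 m) (fun y ↦ g y (Y y) (Z y)) x (X x)
    + mvfderiv (𝓡 m) (fun y ↦ g y (X y) (Z y)) x (Y x)
    - mvfderiv (𝓡 m) (fun y ↦ g y (X y) (Y y)) x (Z x)
    + g x (VectorField.mlieBracket (𝓡 m) X Y x) (Z x)
    - g x (VectorField.mlieBracket (𝓡 m) X Z x) (Y x)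
    - g x (VectorField.mlieBracket (𝓡 m) Y Z x) (X x)

instance instT2Tangent (x : M) : T2Space (TangentSpace (𝓡 m) x) :=
  inferInstanceAs (T2Space (EuclideanSpace ℝ (Fin m)))

theorem koszul_tensorial_left (g : LorentzianMetric m M) {x : M}
    {Y Z : (y : M) → TangentSpace (𝓡 m) y} (hY : DiffFieldAt Y x) (hZ : DiffFieldAt Z x) :
    TensorialAt (𝓡 m) (EuclideanSpace ℝ (Fin m)) (fun X ↦ koszul g X Y Z x) x where
  smul {f X} hf hX := by
    have e1 : (fun y ↦ g y ((f • X) y) (Z y)) = fun y ↦ f y * g y (X y) (Z y) := by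
      funext y; simp
    have e2 : (fun y ↦ g y ((f • X) y) (Y y)) = fun y ↦ f y * g y (X y) (Y y) := by
      funext y; simp
    simp only [koszul]
    rw [e1, e2, mvfderiv_fun_mul hf (mdifferentiableAt_metric g hX hZ),
      mvfderiv_fun_mul hf (mdifferentiableAt_metric g hX hY),
      VectorField.mlieBracket_smul_left hf hX, VectorField.mlieBracket_smul_left hf hX]
    simp
    rw [g.symm x (X x) (Y x), g.symm x (X x) (Z x)]
    ring
  add {X X'} hX hX' := by
    have e1 (Z : (y : M) → TangentSpace (𝓡 m) y) : (fun y ↦ g y ((X + X') y) (Z y)) =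
        fun y ↦ g y (X y) (Z y) + g y (X' y) (Z y) := by
      funext y; simp
    simp only [koszul]
    rw [e1, e1, mvfderiv_fun_add (mdifferentiableAt_metric g hX hZ)
        (mdifferentiableAt_metric g hX' hZ),
      mvfderiv_fun_add (mdifferentiableAt_metric g hX hY) (mdifferentiableAt_metric g hX' hY),
      VectorField.mlieBracket_add_left hX hX', VectorField.mlieBracket_add_left hX hX']
    simp
    ring

theorem koszul_tensorial_right (g : LorentzianMetric m M) {x : M}
    {X Y : (y : M) → TangentSpace (𝓡 m) y} (hX : DiffFieldAt X x) (hY : DiffFieldAt Y x) :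
    TensorialAt (𝓡 m) (EuclideanSpace ℝ (Fin m)) (fun Z ↦ koszul g X Y Z x) x where
  smul {f Z} hf hZ := by
    have e1 (Y : (y : M) → TangentSpace (𝓡 m) y) :
        (fun y ↦ g y (Y y) ((f • Z) y)) = fun y ↦ f y * g y (Y y) (Z y) := by
      funext y; simp
    simp only [koszul]
    rw [e1, e1, mvfderiv_fun_mul hf (mdifferentiableAt_metric g hX hZ),
      mvfderiv_fun_mul hf (mdifferentiableAt_metric g hY hZ),
      VectorField.mlieBracket_smul_right hf hZ, VectorField.mlieBracket_smul_right hf hZ]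
    simp
    rw [g.symm x (Z x) (Y x), g.symm x (Z x) (X x)]
    ring
  add {Z Z'} hZ hZ' := by
    have e1 (Y : (y : M) → TangentSpace (𝓡 m) y) : (fun y ↦ g y (Y y) ((Z + Z') y)) =
        fun y ↦ g y (Y y) (Z y) + g y (Y y) (Z' y) := by
      funext y; simp
    simp only [koszul]
    rw [e1, e1, mvfderiv_fun_add (mdifferentiableAt_metric g hY hZ)
        (mdifferentiableAt_metric g hY hZ'),
      mvfderiv_fun_add (mdifferentiableAt_metric g hX hZ) (mdifferentiableAt_metric g hX hZ'),
      VectorField.mlieBracket_add_right hZ hZ', VectorField.mlieBracket_add_right hZ hZ']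
    simp
    ring

open scoped Classical in
/-- `covD g Y x v` is the Levi-Civita derivative `∇_v Y` at `x`: the vector with
`2 g(∇_v Y, Z) = koszul X Y Z` for all `X` extending `v` and all `Z`
(with the value `0` if `Y` is not differentiable at `x`). -/
def covD (g : LorentzianMetric m M) (Y : (y : M) → TangentSpace (𝓡 m) y) (x : M) :
    TangentSpace (𝓡 m) x →L[ℝ] TangentSpace (𝓡 m) x :=
  if hY : DiffFieldAt Y x then
    LinearMap.toContinuousLinearMap
      ((1 / 2 : ℝ) • (sharp g x ∘ₗ
        (TensorialAt.mkHom₂ (fun X Z ↦ koszul g X Y Z x) x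
          (fun _ hZ ↦ koszul_tensorial_left g hY hZ)
          (fun _ hX ↦ koszul_tensorial_right g hX hY) :
            TangentSpace (𝓡 m) x →L[ℝ] TangentSpace (𝓡 m) x →L[ℝ] ℝ).toLinearMap))
  else 0

theorem koszul_formula (g : LorentzianMetric m M) {x : M}
    {X Y Z : (y : M) → TangentSpace (𝓡 m) y}
    (hX : DiffFieldAt X x) (hY : DiffFieldAt Y x) (hZ : DiffFieldAt Z x) :
    2 * g x (covD g Y x (X x)) (Z x) = koszul g X Y Z x := by
  have h := TensorialAt.mkHom₂_apply (Φ := fun X Z ↦ koszul g X Y Z x)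
    (fun _ hZ ↦ koszul_tensorial_left g hY hZ) (fun _ hX ↦ koszul_tensorial_right g hX hY) hX hZ
  rw [covD, dif_pos hY]
  simp [sharp_spec]
  exact h



/-! The following three facts identify `covD g` as the Levi-Civita connection of `g`. -/

theorem covD_metric (g : LorentzianMetric m M) {x : M}
    {X Y Z : (y : M) → TangentSpace (𝓡 m) y}
    (hX : DiffFieldAt X x) (hY : DiffFieldAt Y x) (hZ : DiffFieldAt Z x) :
    mvfderiv (𝓡 m) (fun y ↦ g y (Y y) (Z y)) x (X x)
      = g x (covD g Y x (X x)) (Z x) + g x (Y x) (covD g Z x (X x)) := by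
  have h1 := koszul_formula g hX hY hZ
  have h2 := koszul_formula g hX hZ hY
  rw [g.symm x _ (Y x)] at h2
  have e : (fun y ↦ g y (Z y) (Y y)) = fun y ↦ g y (Y y) (Z y) := by
    funext y; exact g.symm _ _ _
  simp only [koszul] at h1 h2
  rw [e, VectorField.mlieBracket_swap_apply (V := Z) (W := Y)] at h2
  simp at h2
  linarith

theorem covD_torsion_free (g : LorentzianMetric m M) {x : M}
    {X Y : (y : M) → TangentSpace (𝓡 m) y}
    (hX : DiffFieldAt X x) (hY : DiffFieldAt Y x) :
    covD g Y x (X x) - covD g X x (Y x) = VectorField.mlieBracket (𝓡 m) X Y x := by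
  rw [← sub_eq_zero]
  refine g.eq_zero_of_forall x _ fun z ↦ ?_
  have hZ : DiffFieldAt (FiberBundle.extend (EuclideanSpace ℝ (Fin m)) z) x :=
    FiberBundle.mdifferentiableAt_extend (𝓡 m) (EuclideanSpace ℝ (Fin m)) z
  have h1 := koszul_formula g hX hY hZ
  have h2 := koszul_formula g hY hX hZ
  have e : (fun y ↦ g y (X y) (Y y)) = fun y ↦ g y (Y y) (X y) := by
    funext y; exact g.symm _ _ _
  simp only [koszul] at h1 h2
  rw [VectorField.mlieBracket_swap_apply (V := Y) (W := X)] at h2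
  rw [e] at h1
  simp at h1 h2 ⊢
  linarith

theorem covD_leibniz (g : LorentzianMetric m M) {x : M} {f : M → ℝ}
    {Y : (y : M) → TangentSpace (𝓡 m) y}
    (hf : MDifferentiableAt (𝓡 m) 𝓘(ℝ, ℝ) f x) (hY : DiffFieldAt Y x)
    (v : TangentSpace (𝓡 m) x) :
    covD g (f • Y) x v = f x • covD g Y x v + mvfderiv (𝓡 m) f x v • Y x := by
  rw [← sub_eq_zero]
  refine g.eq_zero_of_forall x _ fun z ↦ ?_
  have hX : DiffFieldAt (FiberBundle.extend (EuclideanSpace ℝ (Fin m)) v) x :=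
    FiberBundle.mdifferentiableAt_extend (𝓡 m) (EuclideanSpace ℝ (Fin m)) v
  have hZ : DiffFieldAt (FiberBundle.extend (EuclideanSpace ℝ (Fin m)) z) x :=
    FiberBundle.mdifferentiableAt_extend (𝓡 m) (EuclideanSpace ℝ (Fin m)) z
  have hfY : DiffFieldAt (f • Y) x := hf.smul_section hY
  have h1 := koszul_formula g hX hY hZ
  have h2 := koszul_formula g hX hfY hZ
  have e1 (Z : (y : M) → TangentSpace (𝓡 m) y) : (fun y ↦ g y ((f • Y) y) (Z y)) = fun y ↦ f y * g y (Y y) (Z y) := by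
    funext y; simp
  have e2 (Z : (y : M) → TangentSpace (𝓡 m) y) : (fun y ↦ g y (Z y) ((f • Y) y)) = fun y ↦ f y * g y (Z y) (Y y) := by
    funext y; simp
  simp only [koszul] at h1 h2
  rw [e1, e2, mvfderiv_fun_mul hf (mdifferentiableAt_metric g hY hZ),
      mvfderiv_fun_mul hf (mdifferentiableAt_metric g hX hY),
      VectorField.mlieBracket_smul_right hf hY, VectorField.mlieBracket_smul_left hf hY] at h2
  simp at h1 h2 ⊢
  rw [g.symm x v (Y x)] at h2
  linear_combination (1/2) * h2 - (f x / 2) * h1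

/-! ## Vector fields, Killing vectors and Killing tensors -/

/-- Smoothness of a vector field on a set. -/
def SmoothFieldOn (X : (y : M) → TangentSpace (𝓡 m) y) (U : Set M) : Prop :=
  ContMDiffOn (𝓡 m) ((𝓡 m).prod 𝓘(ℝ, EuclideanSpace ℝ (Fin m))) ∞
    (fun y ↦ Bundle.TotalSpace.mk' (EuclideanSpace ℝ (Fin m)) y (X y)) U

/-- Smoothness of a real function on a set. -/
def SmoothOn (f : M → ℝ) (U : Set M) : Prop :=
  ContMDiffOn (𝓡 m) 𝓘(ℝ, ℝ) ∞ f U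

/-- A Killing vector field: `∇_α K_β + ∇_β K_α = 0`. -/
structure IsKillingField (g : LorentzianMetric m M) (K : (y : M) → TangentSpace (𝓡 m) y) :
    Prop where
  smooth : SmoothFieldOn K univ
  killing : ∀ (x : M) (v w : TangentSpace (𝓡 m) x),
    g x (covD g K x v) w + g x (covD g K x w) v = 0

/-- The covariant derivative `(∇_u T)(v, w)` of a covariant 2-tensor field. -/
def covDTensor (g : LorentzianMetric m M)
    (T : (y : M) → TangentSpace (𝓡 m) y →L[ℝ] TangentSpace (𝓡 m) y →L[ℝ] ℝ)
    (x : M) (u v w : TangentSpace (𝓡 m) x) : ℝ :=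
  let V := FiberBundle.extend (EuclideanSpace ℝ (Fin m)) v
  let W := FiberBundle.extend (EuclideanSpace ℝ (Fin m)) w
  mvfderiv (𝓡 m) (fun y ↦ T y (V y) (W y)) x u - T x (covD g V x u) w - T x v (covD g W x u)

/-- A smooth Killing tensor of rank two on an open set `U`: symmetric with
`∇_(α K_βγ) = 0`. -/
structure IsKillingTensorOn (g : LorentzianMetric m M) (U : Set M)
    (T : (y : M) → TangentSpace (𝓡 m) y →L[ℝ] TangentSpace (𝓡 m) y →L[ℝ] ℝ) : Prop where
  smooth : ContMDiffOn (𝓡 m)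
    ((𝓡 m).prod 𝓘(ℝ, EuclideanSpace ℝ (Fin m) →L[ℝ] EuclideanSpace ℝ (Fin m) →L[ℝ] ℝ)) ∞
    (fun x ↦ Bundle.TotalSpace.mk'
      (EuclideanSpace ℝ (Fin m) →L[ℝ] EuclideanSpace ℝ (Fin m) →L[ℝ] ℝ) x (T x)) U
  symm : ∀ x ∈ U, ∀ v w, T x v w = T x w v
  killing : ∀ x ∈ U, ∀ u v w,
    covDTensor g T x u v w + covDTensor g T x v w u + covDTensor g T x w u v = 0

/-! ## Foliations of codimension one -/

/-- The gradient of a function. -/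
def grad (g : LorentzianMetric m M) (f : M → ℝ) (x : M) : TangentSpace (𝓡 m) x :=
  sharp g x (mvfderiv (𝓡 m) f x)

/-- A foliation by the level sets of a smooth foliation function `Φ` whose gradient is nowhere
null. `ε = 1` for timelike slices and `ε = -1` for spacelike slices; `σ = ±1` is the choice of sign
of the unit normal. -/
structure Foliation (g : LorentzianMetric m M) where
  /-- the foliation function -/
  Φ : M → ℝ
  /-- the causal type of the slices -/
  ε : ℝ
  /-- the sign in the definition of the unit normal -/
  σ : ℝ
  smooth : SmoothOn (m := m) Φ univ
  ε_eq : ε = 1 ∨ ε = -1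
  σ_eq : σ = 1 ∨ σ = -1
  grad_nonnull : ∀ x, 0 < ε * g x (grad g Φ x) (grad g Φ x)

namespace Foliation

variable {g : LorentzianMetric m M} (F : Foliation g)

/-- The slice `S_s = {Φ = s}`. -/
def slice (s : ℝ) : Set M := F.Φ ⁻¹' {s}

/-- The lapse function `φ = ‖∇Φ‖⁻¹`. -/
def lapse (x : M) : ℝ := (√|g x (grad g F.Φ x) (grad g F.Φ x)|)⁻¹

/-- The unit normal `n = ± φ ∇Φ`. -/
def normal (x : M) : TangentSpace (𝓡 m) x := (F.σ * F.lapse x) • grad g F.Φ x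

/-- The projector `h^α_β = δ^α_β - ε n^α n_β` onto the slices. -/
def proj (x : M) : TangentSpace (𝓡 m) x →L[ℝ] TangentSpace (𝓡 m) x :=
  ContinuousLinearMap.id ℝ _ - F.ε • (g x (F.normal x)).smulRight (F.normal x)

/-- The normal derivative `n^α ∇_α f`. -/
def normalD (f : M → ℝ) (x : M) : ℝ := mvfderiv (𝓡 m) f x (F.normal x)

/-- The tangential derivative `𝒟_γ f = h^λ_γ ∇_λ f` of a function. -/
def tanD (f : M → ℝ) (x : M) (v : TangentSpace (𝓡 m) x) : ℝ :=
  mvfderiv (𝓡 m) f x (F.proj x v)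

/-- The second fundamental form `χ_{αβ} = h^λ_α h^ρ_β ∇_λ n_ρ`. -/
def secondForm (x : M) (v w : TangentSpace (𝓡 m) x) : ℝ :=
  g x (covD g F.normal x (F.proj x v)) (F.proj x w)

/-- The trace `h^{αβ} χ_{αβ}` of the second fundamental form. -/
def meanCurv (x : M) : ℝ :=
  LinearMap.trace ℝ (TangentSpace (𝓡 m) x)
    ((F.proj x).comp ((covD g F.normal x).comp (F.proj x))).toLinearMap

variable {n : ℕ} (K : Fin n → (y : M) → TangentSpace (𝓡 m) y)

/-- A vector tangent to the slice and orthogonal to all the vectors `K_a`. -/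
def IsComplementary (x : M) (X : TangentSpace (𝓡 m) x) : Prop :=
  g x (F.normal x) X = 0 ∧ ∀ a, g x (K a x) X = 0

end Foliation

/-- The Gram matrix `𝒢_{ab} = g(K_a, K_b)`. -/
def gram (g : LorentzianMetric m M) {n : ℕ} (K : Fin n → (y : M) → TangentSpace (𝓡 m) y)
    (x : M) : Matrix (Fin n) (Fin n) ℝ :=
  Matrix.of fun a b ↦ g x (K a x) (K b x)

/-- The inverse Gram matrix `𝒢^{ab}`. -/
def gramInv (g : LorentzianMetric m M) {n : ℕ} (K : Fin n → (y : M) → TangentSpace (𝓡 m) y)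
    (x : M) : Matrix (Fin n) (Fin n) ℝ :=
  (gram g K x)⁻¹

namespace Foliation

variable {g : LorentzianMetric m M} (F : Foliation g) {n : ℕ}
  (K : Fin n → (y : M) → TangentSpace (𝓡 m) y)

/-- The function `χ`: the trace of the second fundamental form over the orthogonal complement, in
the slices, of the span of the `K_a`, divided by the dimension `m - n - 1` of this complement (the
trace over the complement is the full trace minus the trace `𝒢^{ab} χ_{αβ} K_a^α K_b^β` over the
span). -/
def chi (x : M) : ℝ :=
  (F.meanCurv x - ∑ a, ∑ b, gramInv g K x a b * F.secondForm x (K a x) (K b x))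
    / ((m : ℝ) - n - 1)

/-- A vector field on `U` that is tangent to the slices and a Killing vector field in each of them:
`𝒟_(α L_β) = 0`. -/
structure IsSliceKillingFieldOn (U : Set M) (L : (y : M) → TangentSpace (𝓡 m) y) : Prop where
  smooth : SmoothFieldOn L U
  tangent : ∀ x ∈ U, g x (F.normal x) (L x) = 0
  killing : ∀ x ∈ U, ∀ v w : TangentSpace (𝓡 m) x,
    g x (covD g L x (F.proj x v)) (F.proj x w) + g x (covD g L x (F.proj x w)) (F.proj x v) = 0

/-- The tangent projection of `T` to every slice is a reducible Killing tensor of the slice: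
`a h_{αβ} + c^{ij} L_{iα} L_{jβ}` with `L_i` Killing vector fields of the slices,
`c` symmetric, and `a`, `c` constant on the slices. -/
def IsSliceReducibleOn (U : Set M)
    (T : (y : M) → TangentSpace (𝓡 m) y →L[ℝ] TangentSpace (𝓡 m) y →L[ℝ] ℝ) : Prop :=
  ∃ (k : ℕ) (L : Fin k → (y : M) → TangentSpace (𝓡 m) y) (a : M → ℝ)
    (c : M → Matrix (Fin k) (Fin k) ℝ),
    (∀ i, F.IsSliceKillingFieldOn U (L i)) ∧
    SmoothOn (m := m) a U ∧ (∀ i j, SmoothOn (m := m) (fun x ↦ c x i j) U) ∧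
    (∀ x ∈ U, (c x).IsSymm) ∧
    (∀ x ∈ U, ∀ v, F.tanD a x v = 0) ∧
    (∀ i j, ∀ x ∈ U, ∀ v, F.tanD (fun y ↦ c y i j) x v = 0) ∧
    ∀ x ∈ U, ∀ v w, T x (F.proj x v) (F.proj x w) = a x * g x (F.proj x v) (F.proj x w)
      + ∑ i, ∑ j, c x i j * g x (L i x) (F.proj x v) * g x (L j x) (F.proj x w)

/-- `Ψ = ln φ² + Ψ̃`. -/
def psi (Ψt : M → ℝ) (x : M) : ℝ := Real.log (F.lapse x ^ 2) + Ψt x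

/-- The equations for `Ψ̃`, `α`, `γ^{ab}` and `ν^{ab}` on an open set `U`. -/
structure IsSolutionOn (U : Set M) (Ψt α : M → ℝ) (γ ν : M → Matrix (Fin n) (Fin n) ℝ) :
    Prop where
  smooth_Ψt : SmoothOn (m := m) Ψt U
  smooth_α : SmoothOn (m := m) α U
  smooth_γ : ∀ a b, SmoothOn (m := m) (fun x ↦ γ x a b) U
  smooth_ν : ∀ a b, SmoothOn (m := m) (fun x ↦ ν x a b) U
  normalD_Ψt : ∀ x ∈ U, F.normalD Ψt x =
    2 * (F.chi K x - F.normalD (fun y ↦ Real.log (F.lapse y)) x)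
  tanD_Ψt : ∀ x ∈ U, ∀ v, F.tanD Ψt x v = 0
  normalD_α : ∀ x ∈ U, F.normalD α x = -2 * F.ε * F.chi K x * Real.exp (F.psi Ψt x)
  tanD_α : ∀ x ∈ U, ∀ v, F.tanD α x v = 0
  γ_eq : ∀ x ∈ U, ∀ a b, γ x a b = F.ε * Real.exp (F.psi Ψt x) * gramInv g K x a b + ν x a b
  γ_symm : ∀ x ∈ U, (γ x).IsSymm
  normalD_ν : ∀ a b, ∀ x ∈ U, F.normalD (fun y ↦ ν y a b) x = 0
  tanD_γ : ∀ a b, ∀ x ∈ U, ∀ v, F.tanD (fun y ↦ γ y a b) x v = 0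

/-- The tensor `K_{αβ} = α g_{αβ} + γ^{ab} K_{aα} K_{bβ} + e^Ψ n_α n_β`. -/
def liftedTensor (Ψt α : M → ℝ) (γ : M → Matrix (Fin n) (Fin n) ℝ) (x : M) :
    TangentSpace (𝓡 m) x →L[ℝ] TangentSpace (𝓡 m) x →L[ℝ] ℝ :=
  α x • g x + ∑ a, ∑ b, γ x a b • (g x (K a x)).smulRight (g x (K b x))
    + Real.exp (F.psi Ψt x) • (g x (F.normal x)).smulRight (g x (F.normal x))

end Foliation

end SliceKT

end

/-! Killing tensor. The covariant derivative of the lifted tensor is symmetric in its last two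
slots, so by polarization (`cyclic_sum_eq_zero_of_diag`) the Killing equation holds once the cubic
form `u ↦ (∇_u K)(u, u)` vanishes. Write `u = v + ε t n` with `v` tangent to the slice and `t = g(n,
u)`. The terms with `∇K_a` drop out because each `K_a` is Killing, and the rest is `e^Ψ` times a
polynomial in `t`. The `t³` terms cancel between `α g` and the normal derivative of `Ψ`, which
equals `2χ`. The `t²` terms cancel between the tangential derivative of `ln φ²` and the acceleration
`∇_n n`, whose tangential part is `-ε 𝒟 ln φ` (`covD_normal_along_normal`). What remains is linear
in `t` and compares second fundamental forms. Let `k` be the orthogonal projection of `v` to the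
span of the `K_a`. Since `n(𝒢_ab) = 2χ(K_a, K_b)` for Killing fields tangent to the slices
(`normalD_gram`), the derivative of `𝒢^ab` contributes `-2χ(k, k)` (`sum_normalD_gramInv`). Block
diagonality and umbilicity say that `χ(v, v) - χ(k, k)` is the function `χ` times the squared length
of `v - k` (`secondForm_self`), and this cancels the remaining terms from `α` and `γ`. The
computation is assembled in `liftedTensorDeriv_diag`.

Existence. The functions `Ψ̃`, `α` and `γ^ab` have vanishing tangential derivative, so they are
sought as functions of `Φ`. As `n(Φ) = σε/φ`, the normal equations become ordinary differential
equations in the value of `Φ`, with right-hand sides `2σεφ(χ - n ln φ)`, `-2σχφ³e^Ψ̃` and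
`σφ³(2χ𝒢^ab + n𝒢^ab)e^Ψ̃`. The integrability conditions say that these are tangentially constant
(`tanD_integrand_eq_zero` for the last one, with the separate condition where `χ = 0`). On a set
whose slices are connected they are therefore smooth functions of `Φ`, and integrating them
(`exists_primitive_along`) gives the solution. Every point has such a neighbourhood, namely a ball
in coordinates in which `Φ` is affine (`exists_straightening`). -/

set_option linter.unusedSectionVars false

noncomputable section

namespace SliceKT

variable {m : ℕ} {M : Type*} [TopologicalSpace M] [ChartedSpace (EuclideanSpace ℝ (Fin m)) M]
  [IsManifold (𝓡 m) ∞ M]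

/-! ## Smoothness at a point -/

/-- Smoothness of a vector field at a point. -/
abbrev SmoothFieldAt (X : (y : M) → TangentSpace (𝓡 m) y) (x : M) : Prop :=
  ContMDiffAt (𝓡 m) ((𝓡 m).prod 𝓘(ℝ, EuclideanSpace ℝ (Fin m))) ∞
    (fun y ↦ Bundle.TotalSpace.mk' (EuclideanSpace ℝ (Fin m)) y (X y)) x

variable (m) in
/-- Smoothness of a real function at a point. -/
abbrev SmoothAt (f : M → ℝ) (x : M) : Prop :=
  ContMDiffAt (𝓡 m) 𝓘(ℝ, ℝ) ∞ f x

theorem SmoothFieldAt.diffFieldAt {X : (y : M) → TangentSpace (𝓡 m) y} {x : M}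
    (h : SmoothFieldAt X x) : DiffFieldAt X x :=
  h.mdifferentiableAt (by simp)

theorem SmoothAt.mdifferentiableAt {f : M → ℝ} {x : M} (h : SmoothAt m f x) :
    MDifferentiableAt (𝓡 m) 𝓘(ℝ, ℝ) f x :=
  ContMDiffAt.mdifferentiableAt h (by simp)

theorem SmoothAt.mvfderiv_apply {f : M → ℝ} {X : (y : M) → TangentSpace (𝓡 m) y} {x : M}
    (hf : SmoothAt m f x) (hX : SmoothFieldAt X x) :
    SmoothAt m (fun y ↦ mvfderiv (𝓡 m) f y (X y)) x := by
  have h1 := hf.mfderiv_const (m := ∞) (by simp)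
  have h2 : ContMDiffAt (𝓡 m) (𝓘(ℝ, ℝ).prod 𝓘(ℝ, ℝ)) ∞
      (fun y ↦ Bundle.TotalSpace.mk' ℝ (E := fun z : ℝ ↦ TangentSpace 𝓘(ℝ, ℝ) z) (f y)
        (mfderiv (𝓡 m) 𝓘(ℝ, ℝ) f y (X y))) x :=
    ContMDiffAt.clm_apply_of_inCoordinates (b₁ := fun y ↦ y) (b₂ := f) h1 hX hf
  exact (contMDiff_snd_tangentBundle_modelSpace ℝ 𝓘(ℝ, ℝ)).contMDiffAt.comp x h2

theorem LorentzianMetric.smoothAt_apply (g : LorentzianMetric m M) {x : M}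
    {Y Z : (y : M) → TangentSpace (𝓡 m) y} (hY : SmoothFieldAt Y x) (hZ : SmoothFieldAt Z x) :
    SmoothAt m (fun y ↦ g y (Y y) (Z y)) x := by
  have : ContMDiffAt (𝓡 m) ((𝓡 m).prod 𝓘(ℝ)) ∞
      (fun y ↦ Bundle.TotalSpace.mk' ℝ (E := Bundle.Trivial M ℝ) y (g y (Y y) (Z y))) x :=
    ContMDiffAt.clm_bundle_apply₂ (F₁ := EuclideanSpace ℝ (Fin m))
      (F₂ := EuclideanSpace ℝ (Fin m)) (g.contMDiff x) hY hZ
  exact (Bundle.contMDiffAt_section _).1 this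

theorem SmoothFieldAt.mlieBracket {X Y : (y : M) → TangentSpace (𝓡 m) y} {x : M}
    (hX : SmoothFieldAt X x) (hY : SmoothFieldAt Y x) :
    SmoothFieldAt (VectorField.mlieBracket (𝓡 m) X Y) x := by
  have : IsManifold (𝓡 m) ((⊤ : ℕ∞) + 1) M := by simpa using ‹IsManifold (𝓡 m) ∞ M›
  have : IsManifold (𝓡 m) (minSmoothness ℝ 2) M := by
    simpa using IsManifold.of_le (n := ∞) (m := 2) (by norm_cast)
  exact ContMDiffAt.mlieBracket_vectorField (m := ⊤) (n := ⊤) hX hY (by simp)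

theorem SmoothFieldAt.koszul (g : LorentzianMetric m M) {X Y Z : (y : M) → TangentSpace (𝓡 m) y}
    {x : M} (hX : SmoothFieldAt X x) (hY : SmoothFieldAt Y x) (hZ : SmoothFieldAt Z x) :
    SmoothAt m (koszul g X Y Z) x := by
  have h1 := (g.smoothAt_apply hY hZ).mvfderiv_apply hX
  have h2 := (g.smoothAt_apply hX hZ).mvfderiv_apply hY
  have h3 := (g.smoothAt_apply hX hY).mvfderiv_apply hZ
  have h4 := g.smoothAt_apply (hX.mlieBracket hY) hZ
  have h5 := g.smoothAt_apply (hX.mlieBracket hZ) hY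
  have h6 := g.smoothAt_apply (hY.mlieBracket hZ) hX
  exact ((((h1.add h2).sub h3).add h4).sub h5).sub h6

theorem SmoothFieldAt.eventually_diffFieldAt {X : (y : M) → TangentSpace (𝓡 m) y} {x : M}
    (h : SmoothFieldAt X x) : ∀ᶠ y in nhds x, DiffFieldAt X y := by
  have h1 : ContMDiffAt (𝓡 m) ((𝓡 m).prod 𝓘(ℝ, EuclideanSpace ℝ (Fin m))) 1
    (fun y ↦ Bundle.TotalSpace.mk' (EuclideanSpace ℝ (Fin m)) y (X y)) x := h.of_le (by simp)
  filter_upwards [(contMDiffAt_iff_contMDiffAt_nhds (by simp)).1 h1] with y hy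
  exact hy.mdifferentiableAt (by simp)

/-- `covD` is defined pointwise by tensoriality, so its smoothness is read off from the Koszul
expression. The two agree wherever all three fields are differentiable, hence near `x`. -/
theorem SmoothFieldAt.covD_apply (g : LorentzianMetric m M)
    {X Y Z : (y : M) → TangentSpace (𝓡 m) y}
    {x : M} (hX : SmoothFieldAt X x) (hY : SmoothFieldAt Y x) (hZ : SmoothFieldAt Z x) :
    SmoothAt m (fun y ↦ g y (covD g Y y (X y)) (Z y)) x := by
  have h1 : SmoothAt m (fun y ↦ (1 / 2 : ℝ) * SliceKT.koszul g X Y Z y) x :=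
    contMDiffAt_const.mul (hX.koszul g hY hZ)
  refine h1.congr_of_eventuallyEq ?_
  filter_upwards [hX.eventually_diffFieldAt, hY.eventually_diffFieldAt, hZ.eventually_diffFieldAt]
    with y h1 h2 h3
  rw [← koszul_formula g h1 h2 h3]
  ring

/-! ### Matrices of smooth functions -/

theorem smoothAt_det {k : ℕ} {A : M → Matrix (Fin k) (Fin k) ℝ} {x : M}
    (hA : ∀ i j, SmoothAt m (fun y ↦ A y i j) x) : SmoothAt m (fun y ↦ (A y).det) x := by
  simp only [Matrix.det_apply']
  refine contMDiffAt_finsetSum fun σ _ ↦ contMDiffAt_const.mul ?_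
  exact contMDiffAt_finsetProd fun i _ ↦ hA _ _

theorem SmoothAt.inv {f : M → ℝ} {x : M} (hf : SmoothAt m f x) (h : f x ≠ 0) :
    SmoothAt m (fun y ↦ (f y)⁻¹) x :=
  (contDiffAt_inv ℝ h).contMDiffAt.comp x hf

theorem smoothAt_matrix_inv {k : ℕ} {A : M → Matrix (Fin k) (Fin k) ℝ} {x : M}
    (hA : ∀ i j, SmoothAt m (fun y ↦ A y i j) x) (h : (A x).det ≠ 0) (i j : Fin k) :
    SmoothAt m (fun y ↦ (A y)⁻¹ i j) x := by
  have h1 : SmoothAt m (fun y ↦ (A y).adjugate i j) x := by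
    simp only [Matrix.adjugate_apply]
    refine smoothAt_det fun p q ↦ ?_
    by_cases hp : p = j
    · subst hp
      simp only [Matrix.updateRow_self]
      exact contMDiffAt_const
    · simpa only [Matrix.updateRow_ne hp] using hA p q
  refine (((smoothAt_det hA).inv h).mul h1).congr_of_eventuallyEq (.of_forall fun y ↦ ?_)
  simp [Matrix.inv_def, Ring.inverse_eq_inv']

/-! ### Frames and gradients -/

variable (m) in
/-- A frame that is smooth near `x`. -/
def frameAt (x : M) (i : Fin m) (y : M) : TangentSpace (𝓡 m) y :=
  (trivializationAt (EuclideanSpace ℝ (Fin m)) (TangentSpace (𝓡 m)) x).localFrame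
    (EuclideanSpace.basisFun (Fin m) ℝ).toBasis i y

theorem isLocalFrameOn_frameAt (x : M) :
    IsLocalFrameOn (𝓡 m) (EuclideanSpace ℝ (Fin m)) ∞ (frameAt m x)
      (trivializationAt (EuclideanSpace ℝ (Fin m)) (TangentSpace (𝓡 m)) x).baseSet :=
  Bundle.Trivialization.isLocalFrameOn_localFrame_baseSet ..

theorem baseSet_mem_nhds (x : M) :
    (trivializationAt (EuclideanSpace ℝ (Fin m)) (TangentSpace (𝓡 m)) x).baseSet ∈ nhds x :=
  (Bundle.Trivialization.open_baseSet _).mem_nhds (FiberBundle.mem_baseSet_trivializationAt' x)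

theorem smoothFieldAt_frameAt (x : M) (i : Fin m) : SmoothFieldAt (frameAt m x i) x :=
  ((isLocalFrameOn_frameAt x).contMDiffOn i).contMDiffAt (baseSet_mem_nhds x)

theorem SmoothFieldAt.sum {ι : Type*} {s : Finset ι} {f : ι → M → ℝ}
    {X : ι → (y : M) → TangentSpace (𝓡 m) y} {x : M} (hf : ∀ i ∈ s, SmoothAt m (f i) x)
    (hX : ∀ i ∈ s, SmoothFieldAt (X i) x) : SmoothFieldAt (fun y ↦ ∑ i ∈ s, f i y • X i y) x :=
  ContMDiffAt.sum_section fun i hi ↦ (hf i hi).smul_section (hX i hi)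

theorem SmoothFieldAt.smul {f : M → ℝ}
    {X : (y : M) → TangentSpace (𝓡 m) y} {x : M} (hf : SmoothAt m f x)
    (hX : SmoothFieldAt X x) : SmoothFieldAt (fun y ↦ f y • X y) x :=
  hf.smul_section hX

theorem SmoothFieldAt.sub {X Y : (y : M) → TangentSpace (𝓡 m) y} {x : M}
    (hX : SmoothFieldAt X x) (hY : SmoothFieldAt Y x) : SmoothFieldAt (fun y ↦ X y - Y y) x :=
  hX.sub_section hY

theorem LorentzianMetric.frame_gram_det_ne_zero (g : LorentzianMetric m M) {y : M}
    {e : Fin m → TangentSpace (𝓡 m) y} (he : LinearIndependent ℝ e)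
    (he' : ⊤ ≤ Submodule.span ℝ (range e)) :
    (Matrix.of fun i j ↦ g y (e i) (e j)).det ≠ 0 := by
  intro h
  obtain ⟨v, hv, h0⟩ := Matrix.exists_mulVec_eq_zero_iff.2 h
  have hz : ∑ j, v j • e j = 0 := by
    refine g.eq_zero_of_forall y _ fun w ↦ ?_
    obtain ⟨c, rfl⟩ : ∃ c : Fin m → ℝ, ∑ i, c i • e i = w := by
      have := he' (Submodule.mem_top (x := w))
      exact (Submodule.mem_span_range_iff_exists_fun ℝ).1 this
    have h2 : ∀ i, g y (∑ j, v j • e j) (e i) = 0 := by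
      intro i
      have := congrFun h0 i
      rw [g.symm]
      simpa [Matrix.mulVec, dotProduct, mul_comm] using this
    rw [map_sum]
    exact Finset.sum_eq_zero fun i _ ↦ by rw [map_smul, h2, smul_zero]
  exact hv (funext (Fintype.linearIndependent_iff.1 he v hz))

theorem grad_spec (g : LorentzianMetric m M) (f : M → ℝ) (x : M) (v : TangentSpace (𝓡 m) x) :
    g x (grad g f x) v = mvfderiv (𝓡 m) f x v :=
  sharp_spec g x _ v

/-- In a smooth local frame the components of the gradient are the inverse Gram matrix applied to
the derivatives of `f` along the frame, and these are smooth by Cramer's rule. -/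
theorem SmoothAt.grad (g : LorentzianMetric m M) {f : M → ℝ} {x : M} (hf : SmoothAt m f x) :
    SmoothFieldAt (grad g f) x := by
  let A : M → Matrix (Fin m) (Fin m) ℝ := fun y ↦
    Matrix.of fun i j ↦ g y (frameAt m x i y) (frameAt m x j y)
  have hs : IsLocalFrameOn (𝓡 m) (EuclideanSpace ℝ (Fin m)) ∞ (frameAt m x) _ :=
    isLocalFrameOn_frameAt x
  have hA : ∀ i j, SmoothAt m (fun y ↦ A y i j) x := fun i j ↦
    g.smoothAt_apply (smoothFieldAt_frameAt x i) (smoothFieldAt_frameAt x j)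
  have hdet : ∀ y ∈ (trivializationAt (EuclideanSpace ℝ (Fin m)) (TangentSpace (𝓡 m)) x).baseSet,
      (A y).det ≠ 0 := fun y hy ↦
    g.frame_gram_det_ne_zero (hs.linearIndependent hy) (hs.generating hy)
  have hsm : SmoothFieldAt (fun y ↦ ∑ i, (∑ j, (A y)⁻¹ i j * mvfderiv (𝓡 m) f y (frameAt m x j y)) •
      frameAt m x i y) x := by
    refine SmoothFieldAt.sum (fun i _ ↦ contMDiffAt_finsetSum fun j _ ↦ ?_)
      fun i _ ↦ smoothFieldAt_frameAt x i
    exact (smoothAt_matrix_inv hA (hdet x (mem_of_mem_nhds (baseSet_mem_nhds x))) i j).mul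
      (hf.mvfderiv_apply (smoothFieldAt_frameAt x j))
  refine hsm.congr_of_eventuallyEq ?_
  filter_upwards [baseSet_mem_nhds (m := m) x] with y hy
  congr 1
  rw [← sub_eq_zero]
  refine g.eq_zero_of_forall y _ fun w ↦ ?_
  have hk : ∀ k, g y (SliceKT.grad g f y - ∑ i, (∑ j, (A y)⁻¹ i j * mvfderiv (𝓡 m) f y
      (frameAt m x j y)) • frameAt m x i y) (frameAt m x k y) = 0 := by
    intro k
    have h1 : ((A y) * (A y)⁻¹) = 1 := Matrix.mul_nonsing_inv _ (hdet y hy).isUnit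
    have h2 : ∑ i, (∑ j, (A y)⁻¹ i j * mvfderiv (𝓡 m) f y (frameAt m x j y)) * A y k i =
        mvfderiv (𝓡 m) f y (frameAt m x k y) := by
      have : (A y * (A y)⁻¹).mulVec (fun j ↦ mvfderiv (𝓡 m) f y (frameAt m x j y)) k =
        mvfderiv (𝓡 m) f y (frameAt m x k y) := by rw [h1, Matrix.one_mulVec]
      rw [← this, ← Matrix.mulVec_mulVec]
      simp [Matrix.mulVec, dotProduct, mul_comm]
    simp only [map_sub, map_sum, map_smul, FunLike.coe_sub, FunLike.coe_sum, FunLike.coe_smul,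
      Pi.sub_apply, Finset.sum_apply, Pi.smul_apply, smul_eq_mul]
    rw [grad_spec, ← h2, sub_eq_zero]
    refine Finset.sum_congr rfl fun i _ ↦ ?_
    congr 1
    exact g.symm y _ _
  obtain ⟨c, rfl⟩ : ∃ c : Fin m → ℝ, ∑ i, c i • frameAt m x i y = w :=
    (Submodule.mem_span_range_iff_exists_fun ℝ).1 (hs.generating hy (Submodule.mem_top (x := w)))
  simp only [map_sum, map_smul, hk, smul_zero, Finset.sum_const_zero]

/-! ### Rank-one tensors -/

theorem LorentzianMetric.contMDiffAt_smulRight (g : LorentzianMetric m M)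
    {X Y : (y : M) → TangentSpace (𝓡 m) y} {x : M}
    (hX : SmoothFieldAt X x) (hY : SmoothFieldAt Y x) :
    ContMDiffAt (𝓡 m)
      ((𝓡 m).prod 𝓘(ℝ, EuclideanSpace ℝ (Fin m) →L[ℝ] EuclideanSpace ℝ (Fin m) →L[ℝ] ℝ)) ∞
      (fun y ↦ Bundle.TotalSpace.mk'
        (EuclideanSpace ℝ (Fin m) →L[ℝ] EuclideanSpace ℝ (Fin m) →L[ℝ] ℝ)
        (E := fun y ↦ TangentSpace (𝓡 m) y →L[ℝ] TangentSpace (𝓡 m) y →L[ℝ] ℝ) y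
        ((g y (X y)).smulRight (g y (Y y)))) x := by
  have hl : ∀ {X : (y : M) → TangentSpace (𝓡 m) y}, SmoothFieldAt X x →
      ContMDiffAt (𝓡 m) ((𝓡 m).prod 𝓘(ℝ, EuclideanSpace ℝ (Fin m) →L[ℝ] ℝ)) ∞
      (fun y ↦ Bundle.TotalSpace.mk' (EuclideanSpace ℝ (Fin m) →L[ℝ] ℝ)
        (E := fun y ↦ TangentSpace (𝓡 m) y →L[ℝ] ℝ) y (g y (X y))) x := fun hX ↦
    ContMDiffAt.clm_bundle_apply (F₁ := EuclideanSpace ℝ (Fin m))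
      (F₂ := EuclideanSpace ℝ (Fin m) →L[ℝ] ℝ)
      (E₂ := fun y ↦ TangentSpace (𝓡 m) y →L[ℝ] ℝ) (g.contMDiff x) hX
  have hX' := (Bundle.contMDiffAt_section _).1 (hl hX)
  have hY' := (Bundle.contMDiffAt_section _).1 (hl hY)
  rw [Bundle.contMDiffAt_section]
  have hb : ContDiff ℝ ∞ (fun p : (EuclideanSpace ℝ (Fin m) →L[ℝ] ℝ) ×
      (EuclideanSpace ℝ (Fin m) →L[ℝ] ℝ) ↦ p.1.smulRight p.2) :=
    contDiff_fst.smulRight contDiff_snd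
  -- Over the base set the trivialized tensor is the tensor product of the two trivialized
  -- covectors.
  refine (hb.contMDiff.contMDiffAt.comp x (hX'.prodMk_space hY')).congr_of_eventuallyEq ?_
  filter_upwards [baseSet_mem_nhds (m := m) x] with y hy
  ext v w
  simp only [hom_trivializationAt_apply, Function.comp_apply, ContinuousLinearMap.smulRight_apply]
  rw [inCoordinates_apply_eq₂ (E₃ := fun _ ↦ ℝ) hy hy (by simp)]
  simp [ContinuousLinearMap.inCoordinates, Bundle.Trivialization.symmL_apply _ hy]

/-! ## The Lie bracket as a commutator of derivations -/

theorem mvfderiv_eq_fderiv_chart {f : M → ℝ} {x : M}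
    (hf : MDifferentiableAt (𝓡 m) 𝓘(ℝ, ℝ) f x) (v : TangentSpace (𝓡 m) x) :
    mvfderiv (𝓡 m) f x v =
      fderiv ℝ (f ∘ (extChartAt (𝓡 m) x).symm) (extChartAt (𝓡 m) x x) v := by
  rw [hf.mvfderiv]
  simp [writtenInExtChartAt]
  rfl

theorem SmoothAt.contDiffAt_chart {f : M → ℝ} {x : M} (hf : SmoothAt m f x) :
    ContDiffAt ℝ ∞ (f ∘ (extChartAt (𝓡 m) x).symm) (extChartAt (𝓡 m) x x) := by
  have h := (contMDiffAt_iff.1 hf).2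
  simpa only [ModelWithCorners.range_eq_univ, modelWithCornersSelf_coe, range_id,
    contDiffWithinAt_univ, extChartAt_model_space_eq_id, PartialEquiv.refl_coe,
    Function.id_comp] using h

/-- In a chart the first-derivative terms of the commutator give the bracket, and the
second-derivative terms cancel by symmetry. The result is needed for the symmetry of the Hessian. -/
theorem mvfderiv_mlieBracket {f : M → ℝ} {V W : (y : M) → TangentSpace (𝓡 m) y} {x : M}
    (hf : SmoothAt m f x) (hV : SmoothFieldAt V x) (hW : SmoothFieldAt W x) :
    mvfderiv (𝓡 m) f x (VectorField.mlieBracket (𝓡 m) V W x) =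
      mvfderiv (𝓡 m) (fun y ↦ mvfderiv (𝓡 m) f y (W y)) x (V x) -
        mvfderiv (𝓡 m) (fun y ↦ mvfderiv (𝓡 m) f y (V y)) x (W x) := by
  set φ := extChartAt (𝓡 m) x with hφ
  set p := φ x with hp
  have hpt : p ∈ φ.target := mem_extChartAt_target x
  have hxp : φ.symm p = x := extChartAt_to_inv x
  let P (V : (y : M) → TangentSpace (𝓡 m) y) : EuclideanSpace ℝ (Fin m) → EuclideanSpace ℝ (Fin m) :=
    VectorField.mpullbackWithin 𝓘(ℝ, EuclideanSpace ℝ (Fin m)) (𝓡 m) φ.symm V univ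
  have hPd : ∀ {V : (y : M) → TangentSpace (𝓡 m) y}, SmoothFieldAt V x →
      DifferentiableAt ℝ (P V) p := by
    intro V hV
    have := MDifferentiableWithinAt.differentiableWithinAt_mpullbackWithin_vectorField
      (s := univ) (hV.diffFieldAt.mdifferentiableWithinAt)
    rw [preimage_univ, univ_inter, ModelWithCorners.range_eq_univ] at this
    exact differentiableWithinAt_univ.1 this
  have hPp : ∀ V : (y : M) → TangentSpace (𝓡 m) y, P V p = V x := by
    intro V
    have h := mfderivWithin_extChartAt_symm_inverse_apply (I := 𝓡 m) (x := x) (V x)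
    rw [ModelWithCorners.range_eq_univ] at h
    refine Eq.trans ?_ h
    simp only [P, VectorField.mpullbackWithin_apply]
    have : ∀ y (h : y = x), (V y : EuclideanSpace ℝ (Fin m)) = V x := by rintro _ rfl; rfl
    exact congrArg _ (this _ hxp)
  have hbr : mvfderiv (𝓡 m) f x (VectorField.mlieBracket (𝓡 m) V W x) =
      fderiv ℝ (f ∘ φ.symm) p (fderiv ℝ (P W) p (P V p) - fderiv ℝ (P V) p (P W p)) := by
    -- The preferred chart at `x` has identity derivative at `x`, so the bracket computed in the
    -- chart needs no transport back.
    have hinv := isInvertible_mfderiv_extChartAt (I := 𝓡 m) (mem_extChartAt_source (I := 𝓡 m) x)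
    have hid (v : EuclideanSpace ℝ (Fin m)) :
        (mfderiv (𝓡 m) 𝓘(ℝ, EuclideanSpace ℝ (Fin m)) φ x).inverse v = v :=
      (DFunLike.congr_fun (mfderiv_extChartAt_self (I := 𝓡 m) (x := x)) _).symm.trans
        (hinv.self_apply_inverse v)
    have h : VectorField.mlieBracket (𝓡 m) V W x = VectorField.lieBracket ℝ (P V) (P W) p := by
      have h1 := (congrFun (VectorField.mlieBracketWithin_univ (I := 𝓡 m) (V := V) (W := W))
        x).symm.trans VectorField.mlieBracketWithin_apply
      rw [preimage_univ, univ_inter, ModelWithCorners.range_eq_univ] at h1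
      have h2 := congrFun (VectorField.lieBracketWithin_univ (𝕜 := ℝ) (V := P V) (W := P W)) p
      exact (h1.trans (hid _)).trans h2
    exact (congrArg (mvfderiv (𝓡 m) f x) h).trans (mvfderiv_eq_fderiv_chart hf.mdifferentiableAt _)
  have hfs : ContDiffAt ℝ ∞ (f ∘ φ.symm) p := hf.contDiffAt_chart
  have hder : ∀ {V : (y : M) → TangentSpace (𝓡 m) y}, SmoothFieldAt V x →
      ∀ w : EuclideanSpace ℝ (Fin m), mvfderiv (𝓡 m) (fun y ↦ mvfderiv (𝓡 m) f y (V y)) x w =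
      fderiv ℝ (fderiv ℝ (f ∘ φ.symm)) p w (P V p) +
        fderiv ℝ (f ∘ φ.symm) p (fderiv ℝ (P V) p w) := by
    intro V hV w
    -- The pullback applies the inverse of the derivative of `φ.symm`, which undoes the factor from
    -- the chain rule.
    have e : (fun y ↦ mvfderiv (𝓡 m) f y (V y)) ∘ φ.symm =ᶠ[nhds p]
        fun z ↦ fderiv ℝ (f ∘ φ.symm) z (P V z) := by
      have hc : ContinuousAt φ.symm p := continuousAt_extChartAt_symm x
      have h1 : ∀ᶠ y in nhds x, ContMDiffAt (𝓡 m) 𝓘(ℝ, ℝ) 1 f y :=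
        (contMDiffAt_iff_contMDiffAt_nhds (by simp)).1 (hf.of_le (by simp))
      rw [← hxp] at h1
      filter_upwards [hc.eventually h1, extChartAt_target_mem_nhds (I := 𝓡 m) x] with z hz hzt
      have hd := mdifferentiableWithinAt_extChartAt_symm hzt
      rw [ModelWithCorners.range_eq_univ, mdifferentiableWithinAt_univ] at hd
      have hcomp := mvfderiv_comp z (hz.mdifferentiableAt (by simp)) hd
      have hinv := isInvertible_mfderivWithin_extChartAt_symm hzt
      rw [ModelWithCorners.range_eq_univ, mfderivWithin_univ] at hinv
      have h2 : fderiv ℝ (f ∘ φ.symm) z = mvfderiv 𝓘(ℝ, EuclideanSpace ℝ (Fin m)) (f ∘ φ.symm) z := by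
        rw [mvfderiv, mfderiv_eq_fderiv]
        rfl
      rw [h2, hcomp]
      simp only [P, VectorField.mpullbackWithin_apply,
        mfderivWithin_univ, Function.comp_apply]
      exact congrArg (mvfderiv (𝓡 m) f (φ.symm z)) (hinv.self_apply_inverse _).symm
    refine (mvfderiv_eq_fderiv_chart (hf.mvfderiv_apply hV).mdifferentiableAt w).trans ?_
    refine (DFunLike.congr_fun e.fderiv_eq w).trans ?_
    rw [fderiv_clm_apply _ (hPd hV)]
    · exact add_comm _ _
    · exact (hfs.fderiv_right (m := 1) (by norm_cast)).differentiableAt (by simp)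
  have e1 := hder hW (P V p)
  have e2 := hder hV (P W p)
  rw [hPp] at e1 e2
  rw [hbr, e1, e2, ← hPp V, ← hPp W, map_sub,
    (hfs.isSymmSndFDerivAt (by simpa using by norm_cast)).eq (P V p)]
  ring

/-! ## Derivatives of the normal -/

theorem mvfderiv_comp_real {h : ℝ → ℝ} {h' : ℝ} {f : M → ℝ} {x : M}
    (hh : HasDerivAt h h' (f x)) (hf : MDifferentiableAt (𝓡 m) 𝓘(ℝ, ℝ) f x)
    (v : TangentSpace (𝓡 m) x) :
    mvfderiv (𝓡 m) (fun y ↦ h (f y)) x v = h' * mvfderiv (𝓡 m) f x v := by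
  have h1 := (hh.hasFDerivAt.hasMFDerivAt.comp x hf.hasMFDerivAt).mfderiv
  have h2 : mvfderiv (𝓡 m) (fun y ↦ h (f y)) x v = mvfderiv (𝓡 m) f x v * h' :=
    DFunLike.congr_fun h1 v
  rw [h2, mul_comm]

/-- Metric compatibility turns the difference of the two sides into a commutator of derivations of
`f` minus a bracket term, and vanishing torsion makes these equal. -/
theorem covD_grad_symm (g : LorentzianMetric m M) {f : M → ℝ} {x : M} (hf : SmoothAt m f x)
    (v w : TangentSpace (𝓡 m) x) :
    g x (covD g (grad g f) x v) w = g x (covD g (grad g f) x w) v := by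
  have hV : SmoothFieldAt (FiberBundle.extend (EuclideanSpace ℝ (Fin m)) v) x :=
    FiberBundle.contMDiffAt_extend (𝓡 m) (EuclideanSpace ℝ (Fin m)) v
  have hW : SmoothFieldAt (FiberBundle.extend (EuclideanSpace ℝ (Fin m)) w) x :=
    FiberBundle.contMDiffAt_extend (𝓡 m) (EuclideanSpace ℝ (Fin m)) w
  have h1 := covD_metric g hV.diffFieldAt (hf.grad g).diffFieldAt hW.diffFieldAt
  have h2 := covD_metric g hW.diffFieldAt (hf.grad g).diffFieldAt hV.diffFieldAt
  have h3 := mvfderiv_mlieBracket hf hV hW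
  rw [← covD_torsion_free g hV.diffFieldAt hW.diffFieldAt, ← grad_spec g] at h3
  simp only [grad_spec] at h1 h2
  rw [map_sub, h1, h2] at h3
  simp only [FiberBundle.extend_apply_self, grad_spec] at h3
  linarith

theorem IsKillingField.smoothFieldAt {g : LorentzianMetric m M}
    {K : (y : M) → TangentSpace (𝓡 m) y} (hK : IsKillingField g K) (x : M) : SmoothFieldAt K x :=
  hK.smooth.contMDiffAt Filter.univ_mem

/-! ### Lapse, unit normal and second fundamental form of a foliation -/

namespace Foliation

variable {g : LorentzianMetric m M} (F : Foliation g)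

theorem smoothAt_Φ (x : M) : SmoothAt m F.Φ x := F.smooth.contMDiffAt Filter.univ_mem

theorem ε_mul_self : F.ε * F.ε = 1 := by rcases F.ε_eq with h | h <;> rw [h] <;> norm_num

theorem σ_mul_self : F.σ * F.σ = 1 := by rcases F.σ_eq with h | h <;> rw [h] <;> norm_num

theorem abs_grad (x : M) :
    |g x (grad g F.Φ x) (grad g F.Φ x)| = F.ε * g x (grad g F.Φ x) (grad g F.Φ x) := by
  have h := F.grad_nonnull x
  rw [← abs_of_pos h, abs_mul]
  rcases F.ε_eq with h | h <;> simp [h]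

theorem lapse_pos (x : M) : 0 < F.lapse x := by
  rw [lapse, abs_grad]
  exact inv_pos.2 (Real.sqrt_pos.2 (F.grad_nonnull x))

theorem lapse_sq_mul (x : M) :
    F.lapse x ^ 2 * (F.ε * g x (grad g F.Φ x) (grad g F.Φ x)) = 1 := by
  have h := F.grad_nonnull x
  rw [lapse, abs_grad, inv_pow, Real.sq_sqrt h.le, inv_mul_cancel₀ h.ne']

theorem normal_apply (x : M) (v : TangentSpace (𝓡 m) x) :
    g x (F.normal x) v = F.σ * F.lapse x * mvfderiv (𝓡 m) F.Φ x v := by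
  simp [normal, grad_spec]

theorem normal_self (x : M) : g x (F.normal x) (F.normal x) = F.ε := by
  have h := F.lapse_sq_mul x
  simp only [normal, map_smul, FunLike.coe_smul, Pi.smul_apply, smul_eq_mul]
  linear_combination F.ε * h + F.lapse x ^ 2 * g x (grad g F.Φ x) (grad g F.Φ x) *
    (F.σ_mul_self - F.ε_mul_self)

theorem normalD_Φ (x : M) : F.normalD F.Φ x = F.σ * F.ε * (F.lapse x)⁻¹ := by
  have h := F.normal_self x
  rw [normal_apply] at h
  have hl := (F.lapse_pos x).ne'
  rw [normalD]
  field_simp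
  linear_combination F.σ * h - F.lapse x * mvfderiv (𝓡 m) F.Φ x (F.normal x) * F.σ_mul_self

theorem smoothAt_lapse (x : M) : SmoothAt m F.lapse x := by
  have hg := (F.smoothAt_Φ x).grad g
  have h1 : SmoothAt m (fun y ↦ F.ε * g y (grad g F.Φ y) (grad g F.Φ y)) x :=
    contMDiffAt_const.mul (g.smoothAt_apply hg hg)
  have h2 := (Real.contDiffAt_sqrt (n := ∞) (F.grad_nonnull x).ne').contMDiffAt.comp x h1
  have h3 := SmoothAt.inv h2 (Real.sqrt_pos.2 (F.grad_nonnull x)).ne'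
  refine h3.congr_of_eventuallyEq (.of_forall fun y ↦ ?_)
  simp only [lapse, abs_grad, Function.comp_apply]

theorem smoothAt_log_lapse (x : M) : SmoothAt m (fun y ↦ Real.log (F.lapse y)) x :=
  (Real.contDiffAt_log.2 (F.lapse_pos x).ne').contMDiffAt.comp x (F.smoothAt_lapse x)

theorem smoothFieldAt_normal (x : M) : SmoothFieldAt F.normal x :=
  SmoothFieldAt.smul (contMDiffAt_const.mul (F.smoothAt_lapse x)) ((F.smoothAt_Φ x).grad g)

theorem _root_.SliceKT.SmoothAt.normalD {f : M → ℝ} {x : M} (hf : SmoothAt m f x) :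
    SmoothAt m (F.normalD f) x :=
  hf.mvfderiv_apply (F.smoothFieldAt_normal x)

theorem proj_apply (x : M) (v : TangentSpace (𝓡 m) x) :
    F.proj x v = v - (F.ε * g x (F.normal x) v) • F.normal x := by
  simp [proj, mul_smul]

theorem normal_proj (x : M) (v : TangentSpace (𝓡 m) x) : g x (F.normal x) (F.proj x v) = 0 := by
  rw [proj_apply, map_sub, map_smul, normal_self, smul_eq_mul]
  linear_combination -g x (F.normal x) v * F.ε_mul_self

theorem proj_of_tangent {x : M} {v : TangentSpace (𝓡 m) x} (h : g x (F.normal x) v = 0) :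
    F.proj x v = v := by
  rw [proj_apply, h, mul_zero, zero_smul, sub_zero]

theorem mvfderiv_log_lapse (x : M) (v : TangentSpace (𝓡 m) x) :
    mvfderiv (𝓡 m) F.lapse x v =
      F.lapse x * mvfderiv (𝓡 m) (fun y ↦ Real.log (F.lapse y)) x v := by
  have hl := (F.lapse_pos x).ne'
  rw [mvfderiv_comp_real (Real.hasDerivAt_log hl) (F.smoothAt_lapse x).mdifferentiableAt,
    mul_inv_cancel_left₀ hl]

theorem covD_normal_normal (x : M) (v : TangentSpace (𝓡 m) x) :
    g x (covD g F.normal x v) (F.normal x) = 0 := by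
  have hV : SmoothFieldAt (FiberBundle.extend (EuclideanSpace ℝ (Fin m)) v) x :=
    FiberBundle.contMDiffAt_extend (𝓡 m) (EuclideanSpace ℝ (Fin m)) v
  have hn := (F.smoothFieldAt_normal x).diffFieldAt
  have h := covD_metric g hV.diffFieldAt hn hn
  simp only [normal_self, FiberBundle.extend_apply_self, mvfderiv_const] at h
  rw [g.symm x (F.normal x)] at h
  simp at h
  linarith

/-- Since `n = σφ∇Φ` and the Hessian of `Φ` is symmetric, only the derivative of the factor `φ`
survives antisymmetrization: `dn = d ln φ ∧ n`. On tangent vectors this is the symmetry of the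
second fundamental form. -/
theorem covD_normal_antisymm (x : M) (v w : TangentSpace (𝓡 m) x) :
    g x (covD g F.normal x v) w - g x (covD g F.normal x w) v =
      mvfderiv (𝓡 m) (fun y ↦ Real.log (F.lapse y)) x v * g x (F.normal x) w -
      mvfderiv (𝓡 m) (fun y ↦ Real.log (F.lapse y)) x w * g x (F.normal x) v := by
  have hl : SmoothAt m (fun y ↦ F.σ * F.lapse y) x := contMDiffAt_const.mul (F.smoothAt_lapse x)
  have hd : ∀ u, mvfderiv (𝓡 m) (fun y ↦ F.σ * F.lapse y) x u =
      F.σ * (F.lapse x * mvfderiv (𝓡 m) (fun y ↦ Real.log (F.lapse y)) x u) := by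
    intro u
    rw [mvfderiv_fun_mul (mdifferentiableAt_const) (F.smoothAt_lapse x).mdifferentiableAt,
      mvfderiv_const]
    simp [mvfderiv_log_lapse]
  have hn : F.normal = (fun y ↦ F.σ * F.lapse y) • grad g F.Φ := rfl
  have h1 : ∀ u w, g x (covD g F.normal x u) w =
      F.σ * F.lapse x * g x (covD g (grad g F.Φ) x u) w +
      mvfderiv (𝓡 m) (fun y ↦ Real.log (F.lapse y)) x u * g x (F.normal x) w := by
    intro u w
    rw [normal_apply]
    rw [hn, covD_leibniz g hl.mdifferentiableAt ((F.smoothAt_Φ x).grad g).diffFieldAt, hd]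
    simp [grad_spec]
    ring
  rw [h1, h1, covD_grad_symm g (F.smoothAt_Φ x) v w]
  ring

theorem covD_normal_along_normal (x : M) (v : TangentSpace (𝓡 m) x) :
    g x (covD g F.normal x (F.normal x)) v =
      F.normalD (fun y ↦ Real.log (F.lapse y)) x * g x (F.normal x) v -
      F.ε * mvfderiv (𝓡 m) (fun y ↦ Real.log (F.lapse y)) x v := by
  have h := F.covD_normal_antisymm x (F.normal x) v
  rw [covD_normal_normal, normal_self] at h
  rw [normalD]
  linarith

theorem secondForm_of_tangent {x : M} {v w : TangentSpace (𝓡 m) x}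
    (hv : g x (F.normal x) v = 0) (hw : g x (F.normal x) w = 0) :
    F.secondForm x v w = g x (covD g F.normal x v) w := by
  rw [secondForm, F.proj_of_tangent hv, F.proj_of_tangent hw]

theorem secondForm_symm (x : M) (v w : TangentSpace (𝓡 m) x) :
    F.secondForm x v w = F.secondForm x w v := by
  have h := F.covD_normal_antisymm x (F.proj x v) (F.proj x w)
  rw [normal_proj, normal_proj] at h
  rw [secondForm, secondForm]
  linarith

theorem secondForm_add_left (x : M) (v v' w : TangentSpace (𝓡 m) x) :
    F.secondForm x (v + v') w = F.secondForm x v w + F.secondForm x v' w := by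
  simp [secondForm]

theorem secondForm_add_right (x : M) (v w w' : TangentSpace (𝓡 m) x) :
    F.secondForm x v (w + w') = F.secondForm x v w + F.secondForm x v w' := by
  simp [secondForm]

theorem secondForm_sum_left {ι : Type*} (s : Finset ι) (x : M) (c : ι → ℝ)
    (v : ι → TangentSpace (𝓡 m) x) (w : TangentSpace (𝓡 m) x) :
    F.secondForm x (∑ i ∈ s, c i • v i) w = ∑ i ∈ s, c i * F.secondForm x (v i) w := by
  simp [secondForm]

end Foliation

/-! ## The Gram matrix and the orthogonal complement of the Killing fields -/

theorem gram_isSymm (g : LorentzianMetric m M) {n : ℕ} (K : Fin n → (y : M) → TangentSpace (𝓡 m) y)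
    (x : M) : (gram g K x).IsSymm := by
  ext a b
  exact g.symm x _ _

theorem gramInv_isSymm (g : LorentzianMetric m M) {n : ℕ}
    (K : Fin n → (y : M) → TangentSpace (𝓡 m) y) (x : M) : (gramInv g K x).IsSymm := by
  rw [Matrix.IsSymm, gramInv, Matrix.transpose_nonsing_inv, (gram_isSymm g K x).eq]

theorem mvfderiv_finset_sum {ι : Type*} {s : Finset ι} {f : ι → M → ℝ} {x : M}
    (hf : ∀ i ∈ s, SmoothAt m (f i) x) :
    mvfderiv (𝓡 m) (fun y ↦ ∑ i ∈ s, f i y) x = ∑ i ∈ s, mvfderiv (𝓡 m) (f i) x := by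
  classical
  induction s using Finset.induction_on with
  | empty => simpa using mvfderiv_const (0 : ℝ)
  | insert i s hi ih =>
    have h1 := hf i (Finset.mem_insert_self i s)
    have h2 : ∀ j ∈ s, SmoothAt m (f j) x := fun j hj ↦ hf j (Finset.mem_insert_of_mem hj)
    have h3 : SmoothAt m (fun y ↦ ∑ j ∈ s, f j y) x := contMDiffAt_finsetSum h2
    simp only [Finset.sum_insert hi]
    rw [mvfderiv_fun_add h1.mdifferentiableAt h3.mdifferentiableAt, ih h2]

/-- Differentiate `A A⁻¹ = 1`. -/
theorem mvfderiv_matrix_inv {k : ℕ} {A : M → Matrix (Fin k) (Fin k) ℝ} {x : M}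
    (hA : ∀ i j, SmoothAt m (fun y ↦ A y i j) x) (h : ∀ y, IsUnit (A y).det)
    (v : TangentSpace (𝓡 m) x) (i j : Fin k) :
    mvfderiv (𝓡 m) (fun y ↦ (A y)⁻¹ i j) x v =
      -((A x)⁻¹ * (Matrix.of fun p q ↦ mvfderiv (𝓡 m) (fun y ↦ A y p q) x v) * (A x)⁻¹) i j := by
  set D : Matrix (Fin k) (Fin k) ℝ := Matrix.of fun p q ↦ mvfderiv (𝓡 m) (fun y ↦ A y p q) x v
    with hD
  set D' : Matrix (Fin k) (Fin k) ℝ :=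
    Matrix.of fun p q ↦ mvfderiv (𝓡 m) (fun y ↦ (A y)⁻¹ p q) x v with hD'
  have hi : ∀ i j, SmoothAt m (fun y ↦ (A y)⁻¹ i j) x := smoothAt_matrix_inv hA (h x).ne_zero
  have key : A x * D' + D * (A x)⁻¹ = 0 := by
    ext p q
    have h1 : (fun y ↦ ∑ r, A y p r * (A y)⁻¹ r q) =
        fun _ ↦ (1 : Matrix (Fin k) (Fin k) ℝ) p q := by
      funext y
      rw [← Matrix.mul_nonsing_inv _ (h y), Matrix.mul_apply]
    have h2 : mvfderiv (𝓡 m) (fun y ↦ ∑ r, A y p r * (A y)⁻¹ r q) x v = 0 := by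
      rw [h1, mvfderiv_const]; rfl
    rw [mvfderiv_finset_sum (f := fun r y ↦ A y p r * (A y)⁻¹ r q) fun r _ ↦
      (hA p r).mul (hi r q)] at h2
    simp only [Matrix.add_apply, Matrix.mul_apply, ← Finset.sum_add_distrib, Matrix.zero_apply]
    rw [← h2, FunLike.coe_sum, Finset.sum_apply]
    refine Finset.sum_congr rfl fun r _ ↦ ?_
    rw [mvfderiv_fun_mul (hA p r).mdifferentiableAt (hi r q).mdifferentiableAt]
    simp [D, D', mul_comm]
  have key2 : D' = -((A x)⁻¹ * D * (A x)⁻¹) := by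
    have := congrArg ((A x)⁻¹ * ·) key
    simp only [mul_add, mul_zero, ← mul_assoc, Matrix.nonsing_inv_mul _ (h x), one_mul] at this
    exact eq_neg_of_add_eq_zero_left this
  rw [← Matrix.neg_apply, ← key2]
  rfl

theorem smoothAt_gram (g : LorentzianMetric m M) {n : ℕ}
    {K : Fin n → (y : M) → TangentSpace (𝓡 m) y} (hK : ∀ a, IsKillingField g (K a)) (x : M)
    (a b : Fin n) : SmoothAt m (fun y ↦ gram g K y a b) x :=
  g.smoothAt_apply ((hK a).smoothFieldAt x) ((hK b).smoothFieldAt x)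

theorem smoothAt_gramInv (g : LorentzianMetric m M) {n : ℕ}
    {K : Fin n → (y : M) → TangentSpace (𝓡 m) y} (hK : ∀ a, IsKillingField g (K a))
    (hG : ∀ x, IsUnit (gram g K x).det) (x : M) (a b : Fin n) :
    SmoothAt m (fun y ↦ gramInv g K y a b) x :=
  smoothAt_matrix_inv (smoothAt_gram g hK x) (hG x).ne_zero a b

/-- The orthogonal projection onto the span of the `K_a`. -/
def spanProj (g : LorentzianMetric m M) {n : ℕ} (K : Fin n → (y : M) → TangentSpace (𝓡 m) y)
    (x : M) (v : TangentSpace (𝓡 m) x) : TangentSpace (𝓡 m) x :=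
  ∑ a, (∑ b, gramInv g K x a b * g x (K b x) v) • K a x

theorem apply_spanProj (g : LorentzianMetric m M) {n : ℕ}
    {K : Fin n → (y : M) → TangentSpace (𝓡 m) y} {x : M} (hG : IsUnit (gram g K x).det)
    (c : Fin n) (v : TangentSpace (𝓡 m) x) :
    g x (K c x) (spanProj g K x v) = g x (K c x) v := by
  have h1 : (gram g K x * gramInv g K x).mulVec (fun b ↦ g x (K b x) v) c = g x (K c x) v := by
    rw [gramInv, Matrix.mul_nonsing_inv _ hG, Matrix.one_mulVec]
  rw [← Matrix.mulVec_mulVec] at h1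
  rw [← h1, spanProj, map_sum]
  simp [Matrix.mulVec, dotProduct, gram, mul_comm]

namespace Foliation

variable {g : LorentzianMetric m M} (F : Foliation g) {n : ℕ}
  {K : Fin n → (y : M) → TangentSpace (𝓡 m) y}

theorem normal_spanProj (hKtan : ∀ a x, g x (F.normal x) (K a x) = 0) (x : M)
    (v : TangentSpace (𝓡 m) x) : g x (F.normal x) (spanProj g K x v) = 0 := by
  simp [spanProj, hKtan]

variable (K) in
/-- The orthogonal projection onto the complement of the `K_a` in the slices. -/
def complProj (x : M) (v : TangentSpace (𝓡 m) x) : TangentSpace (𝓡 m) x :=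
  F.proj x v - spanProj g K x v

theorem isComplementary_complProj (hKtan : ∀ a x, g x (F.normal x) (K a x) = 0)
    (hG : ∀ x, IsUnit (gram g K x).det) (x : M) (v : TangentSpace (𝓡 m) x) :
    F.IsComplementary K x (F.complProj K x v) := by
  refine ⟨?_, fun a ↦ ?_⟩
  · rw [complProj, map_sub, normal_proj, normal_spanProj F hKtan, sub_zero]
  · rw [complProj, map_sub, apply_spanProj g (hG x), proj_apply, map_sub, map_smul,
      g.symm x (K a x) (F.normal x), hKtan]
    simp

theorem complProj_of_isComplementary {x : M} {X : TangentSpace (𝓡 m) x}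
    (hX : F.IsComplementary K x X) : F.complProj K x X = X := by
  rw [complProj, F.proj_of_tangent hX.1]
  simp [spanProj, hX.2]

theorem apply_spanProj_of_isComplementary {x : M} {X : TangentSpace (𝓡 m) x}
    (hX : F.IsComplementary K x X) (v : TangentSpace (𝓡 m) x) :
    g x X (spanProj g K x v) = 0 := by
  rw [g.symm]
  simp [spanProj, hX.2]

/-- Orthogonality to `n` and to the `K_a` imposes `n + 1 < m` linear conditions. -/
theorem exists_isComplementary_ne_zero (hn : n + 2 ≤ m) (x : M) :
    ∃ X, F.IsComplementary K x X ∧ X ≠ 0 := by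
  let L : TangentSpace (𝓡 m) x →ₗ[ℝ] (ℝ × (Fin n → ℝ)) :=
    (g x (F.normal x)).toLinearMap.prod (LinearMap.pi fun a ↦ (g x (K a x)).toLinearMap)
  have hL : LinearMap.ker L ≠ ⊥ := by
    refine LinearMap.ker_ne_bot_of_finrank_lt ?_
    have : Module.finrank ℝ (TangentSpace (𝓡 m) x) = m :=
      finrank_euclideanSpace_fin (𝕜 := ℝ) (n := m)
    rw [this]
    simp
    omega
  obtain ⟨X, hX, h0⟩ := Submodule.exists_mem_ne_zero_of_ne_bot hL
  have h1 : L X = 0 := hX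
  exact ⟨X, ⟨congrArg Prod.fst h1, fun a ↦ congrFun (congrArg Prod.snd h1) a⟩, h0⟩

/-- If every complementary vector were null, polarization would make the complement totally
isotropic. Being orthogonal to the normal and to the `K_a` as well, it would be orthogonal to
everything, hence zero. -/
theorem exists_isComplementary_self_ne_zero (hn : n + 2 ≤ m)
    (hKtan : ∀ a x, g x (F.normal x) (K a x) = 0)
    (hG : ∀ x, IsUnit (gram g K x).det) (x : M) :
    ∃ X, F.IsComplementary K x X ∧ g x X X ≠ 0 := by
  by_contra! hcon
  obtain ⟨X, hX, h0⟩ := F.exists_isComplementary_ne_zero (K := K) hn x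
  refine h0 (g.eq_zero_of_forall x X fun w ↦ ?_)
  have hY := F.isComplementary_complProj hKtan hG x w
  set Y := F.complProj K x w with hYdef
  have hw : w = Y + spanProj g K x w + (F.ε * g x (F.normal x) w) • F.normal x := by
    rw [hYdef, complProj, proj_apply]
    abel
  have hXY : g x X Y = 0 := by
    have hadd : F.IsComplementary K x (X + Y) :=
      ⟨by rw [map_add, hX.1, hY.1, add_zero], fun a ↦ by rw [map_add, hX.2, hY.2, add_zero]⟩
    have h1 := hcon _ hadd
    have h2 := hcon _ hX
    have h3 := hcon _ hY
    simp only [map_add, FunLike.coe_add, Pi.add_apply] at h1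
    rw [g.symm x Y X] at h1
    linarith
  rw [hw, map_add, map_add, hXY, F.apply_spanProj_of_isComplementary hX, map_smul,
    g.symm x X, hX.1]
  simp

theorem smoothFieldAt_complProj (hK : ∀ a, IsKillingField g (K a))
    (hG : ∀ x, IsUnit (gram g K x).det) {V : (y : M) → TangentSpace (𝓡 m) y} {x : M}
    (hV : SmoothFieldAt V x) : SmoothFieldAt (fun y ↦ F.complProj K y (V y)) x := by
  have hn := F.smoothFieldAt_normal x
  have h1 : SmoothFieldAt (fun y ↦ F.proj y (V y)) x := by
    have : SmoothFieldAt (fun y ↦ V y - (F.ε * g y (F.normal y) (V y)) • F.normal y) x :=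
      hV.sub (SmoothFieldAt.smul (contMDiffAt_const.mul (g.smoothAt_apply hn hV)) hn)
    simpa only [proj_apply] using this
  refine h1.sub (SmoothFieldAt.sum (fun a _ ↦ contMDiffAt_finsetSum fun b _ ↦ ?_)
    fun a _ ↦ (hK a).smoothFieldAt x)
  exact (smoothAt_gramInv g hK hG x a b).mul (g.smoothAt_apply ((hK b).smoothFieldAt x) hV)

/-- By umbilicity `χ` is the quotient of the second fundamental form and the metric on any non-null
complementary field. This avoids differentiating the trace in the definition of `chi`. The field is
obtained by projecting an extension of a non-null complementary vector at `x`. -/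
theorem smoothAt_chi (hn : n + 2 ≤ m) (hK : ∀ a, IsKillingField g (K a))
    (hKtan : ∀ a x, g x (F.normal x) (K a x) = 0) (hG : ∀ x, IsUnit (gram g K x).det)
    (humb : ∀ x X Y, F.IsComplementary K x X → F.IsComplementary K x Y →
      F.secondForm x X Y = F.chi K x * g x X Y) (x : M) : SmoothAt m (F.chi K) x := by
  obtain ⟨X, hX, h0⟩ := F.exists_isComplementary_self_ne_zero hn hKtan hG x
  have hV : SmoothFieldAt (FiberBundle.extend (EuclideanSpace ℝ (Fin m)) X) x :=
    FiberBundle.contMDiffAt_extend (𝓡 m) (EuclideanSpace ℝ (Fin m)) X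
  set W : (y : M) → TangentSpace (𝓡 m) y := fun y ↦ F.complProj K y
    (FiberBundle.extend (EuclideanSpace ℝ (Fin m)) X y) with hWdef
  have hW : SmoothFieldAt W x := F.smoothFieldAt_complProj hK hG hV
  have hWc : ∀ y, F.IsComplementary K y (W y) := fun y ↦ F.isComplementary_complProj hKtan hG y _
  have hWx : W x = X := by
    simp only [hWdef, FiberBundle.extend_apply_self]
    exact F.complProj_of_isComplementary hX
  have h1 : SmoothAt m (fun y ↦ g y (W y) (W y)) x := g.smoothAt_apply hW hW
  have h2 := hW.covD_apply g (F.smoothFieldAt_normal x) hW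
  have h0' : g x (W x) (W x) ≠ 0 := by rwa [hWx]
  refine ((h1.inv h0').mul h2).congr_of_eventuallyEq ?_
  filter_upwards [h1.continuousAt.eventually_ne h0'] with y hy
  have h3 := humb y _ _ (hWc y) (hWc y)
  rw [F.secondForm_of_tangent (hWc y).1 (hWc y).1] at h3
  simp only [Pi.mul_apply]
  rw [h3]
  field_simp

/-- The Killing equation gives `g(∇_n K_a, K_b) = -g(∇_{K_b} K_a, n)`, and differentiating `g(n,
K_a) = 0` along `K_b` turns this into `g(∇_{K_b} n, K_a)`. -/
theorem normalD_gram (hK : ∀ a, IsKillingField g (K a))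
    (hKtan : ∀ a x, g x (F.normal x) (K a x) = 0) (x : M) (a b : Fin n) :
    F.normalD (fun y ↦ gram g K y a b) x = 2 * F.secondForm x (K a x) (K b x) := by
  have hn := (F.smoothFieldAt_normal x).diffFieldAt
  have hd := fun a ↦ ((hK a).smoothFieldAt x).diffFieldAt
  have h1 := covD_metric g hn (hd a) (hd b)
  have h2 : ∀ a b, g x (covD g (K a) x (F.normal x)) (K b x) =
      F.secondForm x (K b x) (K a x) := by
    intro a b
    have h3 := (hK a).killing x (F.normal x) (K b x)
    have h4 := covD_metric g (hd b) hn (hd a)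
    simp only [hKtan, mvfderiv_const] at h4
    rw [F.secondForm_of_tangent (hKtan b x) (hKtan a x)]
    rw [g.symm x (F.normal x)] at h4
    simp at h4
    linarith
  rw [g.symm x (K a x), h2, h2, F.secondForm_symm x (K b x)] at h1
  rw [two_mul]
  exact h1

theorem normalD_gramInv (hK : ∀ a, IsKillingField g (K a))
    (hKtan : ∀ a x, g x (F.normal x) (K a x) = 0) (hG : ∀ x, IsUnit (gram g K x).det) (x : M)
    (a b : Fin n) :
    F.normalD (fun y ↦ gramInv g K y a b) x = -(gramInv g K x *
      (Matrix.of fun c d ↦ 2 * F.secondForm x (K c x) (K d x)) * gramInv g K x) a b := by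
  refine (mvfderiv_matrix_inv (smoothAt_gram g hK x) hG (F.normal x) a b).trans ?_
  have h := fun c d ↦ F.normalD_gram hK hKtan x c d
  simp only [normalD] at h
  simp only [h]
  rfl

/-- The derivative of `𝒢⁻¹` is `-𝒢⁻¹ (2χ(K_c, K_d)) 𝒢⁻¹`, and `𝒢⁻¹` applied to the numbers `g(K_a,
v)` gives the coefficients of the projection of `v` to the span. -/
theorem sum_normalD_gramInv (hK : ∀ a, IsKillingField g (K a))
    (hKtan : ∀ a x, g x (F.normal x) (K a x) = 0) (hG : ∀ x, IsUnit (gram g K x).det) (x : M)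
    (v : TangentSpace (𝓡 m) x) :
    ∑ a, ∑ b, F.normalD (fun y ↦ gramInv g K y a b) x * g x (K a x) v * g x (K b x) v =
      -2 * F.secondForm x (spanProj g K x v) (spanProj g K x v) := by
  set κ : Fin n → ℝ := fun a ↦ g x (K a x) v with hκ
  set S : Matrix (Fin n) (Fin n) ℝ := Matrix.of fun c d ↦ 2 * F.secondForm x (K c x) (K d x)
    with hS
  have h1 : ∑ a, ∑ b, F.normalD (fun y ↦ gramInv g K y a b) x * κ a * κ b =
      -(κ ⬝ᵥ (gramInv g K x * S * gramInv g K x).mulVec κ) := by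
    simp only [F.normalD_gramInv hK hKtan hG, dotProduct, Matrix.mulVec, Finset.mul_sum,
      ← Finset.sum_neg_distrib]
    refine Finset.sum_congr rfl fun a _ ↦ Finset.sum_congr rfl fun b _ ↦ ?_
    ring
  have h2 : ∀ w, F.secondForm x (spanProj g K x v) w =
      ∑ a, (gramInv g K x).mulVec κ a * F.secondForm x (K a x) w := fun w ↦
    F.secondForm_sum_left _ x _ _ w
  have h3 : 2 * F.secondForm x (spanProj g K x v) (spanProj g K x v) =
      (gramInv g K x).mulVec κ ⬝ᵥ S.mulVec ((gramInv g K x).mulVec κ) := by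
    rw [h2]
    simp only [F.secondForm_symm x _ (spanProj g K x v), h2]
    generalize (gramInv g K x).mulVec κ = c
    simp only [dotProduct, Matrix.mulVec, hS, Matrix.of_apply, Finset.mul_sum]
    refine Finset.sum_congr rfl fun a _ ↦ Finset.sum_congr rfl fun b _ ↦ ?_
    rw [F.secondForm_symm x (K b x)]
    ring
  rw [h1, neg_mul, h3, ← Matrix.mulVec_mulVec, ← Matrix.mulVec_mulVec, Matrix.dotProduct_mulVec,
    ← Matrix.mulVec_transpose, (gramInv_isSymm g K x).eq]

/-- Split `v` orthogonally as `X + k` with `X` complementary and `k` in the span of the `K_a`. The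
mixed terms vanish by block diagonality, umbilicity evaluates the `X` term, and `g(X, X) = g(v, v) -
g(k, v)`. -/
theorem secondForm_self (hKtan : ∀ a x, g x (F.normal x) (K a x) = 0)
    (hG : ∀ x, IsUnit (gram g K x).det)
    (hblock : ∀ x a X, F.IsComplementary K x X → F.secondForm x (K a x) X = 0)
    (humb : ∀ x X Y, F.IsComplementary K x X → F.IsComplementary K x Y →
      F.secondForm x X Y = F.chi K x * g x X Y) (x : M) {v : TangentSpace (𝓡 m) x}
    (hv : g x (F.normal x) v = 0) :
    F.secondForm x v v =
      F.chi K x * (g x v v - ∑ a, ∑ b, gramInv g K x a b * g x (K a x) v * g x (K b x) v) +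
      F.secondForm x (spanProj g K x v) (spanProj g K x v) := by
  have hX := F.isComplementary_complProj hKtan hG x v
  set X := F.complProj K x v with hXdef
  set k := spanProj g K x v with hk
  have hvX : v = X + k := by rw [hXdef, complProj, F.proj_of_tangent hv]; abel
  have hkX : F.secondForm x k X = 0 := by
    rw [hk, spanProj, secondForm_sum_left]
    simp [hblock x _ X hX]
  have hgk : g x k v = ∑ a, ∑ b, gramInv g K x a b * g x (K a x) v * g x (K b x) v := by
    simp only [hk, spanProj, map_sum, map_smul, FunLike.coe_sum, FunLike.coe_smul,
      Finset.sum_apply, Pi.smul_apply, smul_eq_mul, Finset.sum_mul]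
    exact Finset.sum_congr rfl fun a _ ↦ Finset.sum_congr rfl fun b _ ↦ by ring
  have hgX : g x X X = g x v v - g x k v := by
    have h1 : g x X k = 0 := F.apply_spanProj_of_isComplementary hX v
    have h2 : X = v - k := by rw [hvX]; abel
    have h3 : g x X X = g x X v := by
      conv_rhs => rw [hvX]
      rw [map_add, h1, add_zero]
    rw [h3]
    conv_lhs => rw [h2]
    simp
  have h4 : F.secondForm x v v = F.secondForm x X X + F.secondForm x k k := by
    conv_lhs => rw [hvX]
    rw [secondForm_add_left, secondForm_add_right, secondForm_add_right, hkX,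
      F.secondForm_symm x X k, hkX]
    ring
  rw [h4, humb x X X hX hX, hgX, hgk]

end Foliation

/-! ## The lifted Killing tensor -/

theorem mvfderiv_congr {f h : M → ℝ} {x : M} (e : f =ᶠ[nhds x] h) (v : TangentSpace (𝓡 m) x) :
    mvfderiv (𝓡 m) f x v = mvfderiv (𝓡 m) h x v :=
  congrArg (fun L : TangentSpace (𝓡 m) x →L[ℝ] ℝ ↦ L v)
    (Filter.EventuallyEq.mfderiv_eq (I := 𝓡 m) (I' := 𝓘(ℝ, ℝ)) e)

theorem SmoothAt.mvfderiv_mul {f h : M → ℝ} {x : M} (hf : SmoothAt m f x) (hh : SmoothAt m h x)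
    (v : TangentSpace (𝓡 m) x) :
    mvfderiv (𝓡 m) (fun y ↦ f y * h y) x v =
      f x * mvfderiv (𝓡 m) h x v + h x * mvfderiv (𝓡 m) f x v := by
  rw [mvfderiv_fun_mul hf.mdifferentiableAt hh.mdifferentiableAt]
  rfl

theorem SmoothAt.mvfderiv_add {f h : M → ℝ} {x : M} (hf : SmoothAt m f x) (hh : SmoothAt m h x)
    (v : TangentSpace (𝓡 m) x) :
    mvfderiv (𝓡 m) (fun y ↦ f y + h y) x v =
      mvfderiv (𝓡 m) f x v + mvfderiv (𝓡 m) h x v := by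
  rw [mvfderiv_fun_add hf.mdifferentiableAt hh.mdifferentiableAt]
  rfl

theorem SmoothAt.mvfderiv_const_mul {f : M → ℝ} {x : M} (c : ℝ) (hf : SmoothAt m f x)
    (v : TangentSpace (𝓡 m) x) :
    mvfderiv (𝓡 m) (fun y ↦ c * f y) x v = c * mvfderiv (𝓡 m) f x v := by
  have h : SmoothAt m (fun _ : M ↦ c) x := contMDiffAt_const
  rw [SmoothAt.mvfderiv_mul h hf, mvfderiv_const]
  simp

theorem SmoothAt.exp {f : M → ℝ} {x : M} (hf : SmoothAt m f x) :
    SmoothAt m (fun y ↦ Real.exp (f y)) x :=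
  Real.contDiff_exp.contDiffAt.contMDiffAt.comp x hf

theorem SmoothAt.mvfderiv_exp {f : M → ℝ} {x : M} (hf : SmoothAt m f x)
    (v : TangentSpace (𝓡 m) x) :
    mvfderiv (𝓡 m) (fun y ↦ Real.exp (f y)) x v = Real.exp (f x) * mvfderiv (𝓡 m) f x v :=
  mvfderiv_comp_real (Real.hasDerivAt_exp _) hf.mdifferentiableAt v

/-- Polarization of a cubic form: inclusion–exclusion over `u + v + w` isolates the sum over all six
permutations, which is twice the cyclic sum by the symmetry in the last two slots. -/
theorem cyclic_sum_eq_zero_of_diag {E : Type*} [AddCommGroup E] {C : E → E → E → ℝ}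
    (h1 : ∀ u u' v w, C (u + u') v w = C u v w + C u' v w)
    (h2 : ∀ u v v' w, C u (v + v') w = C u v w + C u v' w)
    (hs : ∀ u v w, C u v w = C u w v) (h0 : ∀ u, C u u u = 0) (u v w : E) :
    C u v w + C v w u + C w u v = 0 := by
  have h3 : ∀ u v w w', C u v (w + w') = C u v w + C u v w' := fun u v w w' ↦ by
    rw [hs, h2, hs u w v, hs u w' v]
  have e1 := h0 (u + v + w)
  have e2 := h0 (u + v)
  have e3 := h0 (u + w)
  have e4 := h0 (v + w)
  have e5 := h0 u
  have e6 := h0 v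
  have e7 := h0 w
  simp only [h1, h2, h3] at e1 e2 e3 e4
  linarith [hs u v w, hs v w u, hs w u v]

namespace Foliation

variable {g : LorentzianMetric m M} (F : Foliation g) {n : ℕ}
  {K : Fin n → (y : M) → TangentSpace (𝓡 m) y}

theorem psi_eq (Ψt : M → ℝ) : F.psi Ψt = fun y ↦ 2 * Real.log (F.lapse y) + Ψt y := by
  funext y
  simp [psi]

theorem smoothAt_psi {Ψt : M → ℝ} {x : M} (h : SmoothAt m Ψt x) : SmoothAt m (F.psi Ψt) x := by
  rw [psi_eq]
  exact (contMDiffAt_const.mul (F.smoothAt_log_lapse x)).add h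

theorem mvfderiv_psi {Ψt : M → ℝ} {x : M} (h : SmoothAt m Ψt x) (v : TangentSpace (𝓡 m) x) :
    mvfderiv (𝓡 m) (F.psi Ψt) x v = 2 * mvfderiv (𝓡 m) (fun y ↦ Real.log (F.lapse y)) x v +
      mvfderiv (𝓡 m) Ψt x v := by
  have h1 : SmoothAt m (fun y ↦ 2 * Real.log (F.lapse y)) x :=
    contMDiffAt_const.mul (F.smoothAt_log_lapse x)
  rw [psi_eq, h1.mvfderiv_add h, (F.smoothAt_log_lapse x).mvfderiv_const_mul]

variable (K) in
/-- The covariant derivative of the lifted tensor, expanded by the Leibniz rule. -/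
def liftedTensorDeriv (Ψt α : M → ℝ) (γ : M → Matrix (Fin n) (Fin n) ℝ) (x : M)
    (u v w : TangentSpace (𝓡 m) x) : ℝ :=
  mvfderiv (𝓡 m) α x u * g x v w
    + ∑ a, ∑ b, (mvfderiv (𝓡 m) (fun y ↦ γ y a b) x u * (g x (K a x) v * g x (K b x) w)
      + γ x a b * (g x (covD g (K a) x u) v * g x (K b x) w
        + g x (K a x) v * g x (covD g (K b) x u) w))
    + Real.exp (F.psi Ψt x) * (mvfderiv (𝓡 m) (F.psi Ψt) x u *
        (g x (F.normal x) v * g x (F.normal x) w)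
      + (g x (covD g F.normal x u) v * g x (F.normal x) w
        + g x (F.normal x) v * g x (covD g F.normal x u) w))

theorem covDTensor_liftedTensor (hK : ∀ a, IsKillingField g (K a)) {Ψt α : M → ℝ}
    {γ : M → Matrix (Fin n) (Fin n) ℝ} {x : M} (hΨ : SmoothAt m Ψt x) (hα : SmoothAt m α x)
    (hγ : ∀ a b, SmoothAt m (fun y ↦ γ y a b) x) (u v w : TangentSpace (𝓡 m) x) :
    covDTensor g (F.liftedTensor K Ψt α γ) x u v w = F.liftedTensorDeriv K Ψt α γ x u v w := by
  have hs : ∀ v : TangentSpace (𝓡 m) x,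
      SmoothFieldAt (FiberBundle.extend (EuclideanSpace ℝ (Fin m)) v) x := fun v ↦
    FiberBundle.contMDiffAt_extend (𝓡 m) (EuclideanSpace ℝ (Fin m)) v
  set V := FiberBundle.extend (EuclideanSpace ℝ (Fin m)) v with hV
  set W := FiberBundle.extend (EuclideanSpace ℝ (Fin m)) w with hW
  have hVx : V x = v := FiberBundle.extend_apply_self _ _
  have hWx : W x = w := FiberBundle.extend_apply_self _ _
  have hVs : SmoothFieldAt V x := hs v
  have hWs : SmoothFieldAt W x := hs w
  have hd : ∀ {Y Z : (y : M) → TangentSpace (𝓡 m) y}, SmoothFieldAt Y x → SmoothFieldAt Z x →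
      mvfderiv (𝓡 m) (fun y ↦ g y (Y y) (Z y)) x u =
        g x (covD g Y x u) (Z x) + g x (Y x) (covD g Z x u) := fun hY hZ ↦ by
    simpa only [FiberBundle.extend_apply_self] using
      covD_metric g (hs u).diffFieldAt hY.diffFieldAt hZ.diffFieldAt
  have hKs := fun a ↦ (hK a).smoothFieldAt x
  have hns := F.smoothFieldAt_normal x
  have hΨs := F.smoothAt_psi hΨ
  have hKV := fun a ↦ g.smoothAt_apply (hKs a) hVs
  have hKW := fun a ↦ g.smoothAt_apply (hKs a) hWs
  have hnV := g.smoothAt_apply hns hVs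
  have hnW := g.smoothAt_apply hns hWs
  have hVW := g.smoothAt_apply hVs hWs
  have e : (fun y ↦ F.liftedTensor K Ψt α γ y (V y) (W y)) = fun y ↦
      (α y * g y (V y) (W y)
        + ∑ a, ∑ b, γ y a b * (g y (K a y) (V y) * g y (K b y) (W y)))
        + Real.exp (F.psi Ψt y) * (g y (F.normal y) (V y) * g y (F.normal y) (W y)) := by
    funext y
    simp [liftedTensor]
  have s1 : SmoothAt m (fun y ↦ α y * g y (V y) (W y)) x := hα.mul hVW
  have s2 : ∀ a b, SmoothAt m (fun y ↦ γ y a b * (g y (K a y) (V y) * g y (K b y) (W y))) x :=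
    fun a b ↦ (hγ a b).mul ((hKV a).mul (hKW b))
  have s3 : ∀ a, SmoothAt m
      (fun y ↦ ∑ b, γ y a b * (g y (K a y) (V y) * g y (K b y) (W y))) x :=
    fun a ↦ contMDiffAt_finsetSum fun b _ ↦ s2 a b
  have s4 : SmoothAt m
      (fun y ↦ ∑ a, ∑ b, γ y a b * (g y (K a y) (V y) * g y (K b y) (W y))) x :=
    contMDiffAt_finsetSum fun a _ ↦ s3 a
  have s5 : SmoothAt m (fun y ↦ Real.exp (F.psi Ψt y) *
      (g y (F.normal y) (V y) * g y (F.normal y) (W y))) x := hΨs.exp.mul (hnV.mul hnW)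
  have s6 : ∀ a b, SmoothAt m (fun y ↦ g y (K a y) (V y) * g y (K b y) (W y)) x :=
    fun a b ↦ (hKV a).mul (hKW b)
  have s7 : SmoothAt m (fun y ↦ g y (F.normal y) (V y) * g y (F.normal y) (W y)) x := hnV.mul hnW
  have s8 : SmoothAt m (fun y ↦ α y * g y (V y) (W y)
      + ∑ a, ∑ b, γ y a b * (g y (K a y) (V y) * g y (K b y) (W y))) x := s1.add s4
  have d2 : ∀ a b, mvfderiv (𝓡 m)
      (fun y ↦ γ y a b * (g y (K a y) (V y) * g y (K b y) (W y))) x u =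
      mvfderiv (𝓡 m) (fun y ↦ γ y a b) x u * (g x (K a x) v * g x (K b x) w)
      + γ x a b * ((g x (covD g (K a) x u) v + g x (K a x) (covD g V x u)) * g x (K b x) w
        + g x (K a x) v * (g x (covD g (K b) x u) w + g x (K b x) (covD g W x u))) := by
    intro a b
    rw [(hγ a b).mvfderiv_mul (s6 a b), (hKV a).mvfderiv_mul (hKW b),
      hd (hKs a) hVs, hd (hKs b) hWs, hVx, hWx]
    ring
  have d4 : mvfderiv (𝓡 m)
      (fun y ↦ ∑ a, ∑ b, γ y a b * (g y (K a y) (V y) * g y (K b y) (W y))) x u =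
      ∑ a, ∑ b, (mvfderiv (𝓡 m) (fun y ↦ γ y a b) x u * (g x (K a x) v * g x (K b x) w)
      + γ x a b * ((g x (covD g (K a) x u) v + g x (K a x) (covD g V x u)) * g x (K b x) w
        + g x (K a x) v * (g x (covD g (K b) x u) w + g x (K b x) (covD g W x u)))) := by
    rw [mvfderiv_finset_sum fun a _ ↦ s3 a, FunLike.coe_sum, Finset.sum_apply]
    refine Finset.sum_congr rfl fun a _ ↦ ?_
    rw [mvfderiv_finset_sum fun b _ ↦ s2 a b, FunLike.coe_sum, Finset.sum_apply]
    exact Finset.sum_congr rfl fun b _ ↦ d2 a b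
  have T : ∀ v' w' : TangentSpace (𝓡 m) x, F.liftedTensor K Ψt α γ x v' w' =
      (α x * g x v' w'
        + ∑ a, ∑ b, γ x a b * (g x (K a x) v' * g x (K b x) w'))
        + Real.exp (F.psi Ψt x) * (g x (F.normal x) v' * g x (F.normal x) w') := by
    intro v' w'
    simp [liftedTensor]
  -- Separates the terms with `∇V` and `∇W`, which the correction terms of `covDTensor` cancel.
  have split : ∑ a, ∑ b, (mvfderiv (𝓡 m) (fun y ↦ γ y a b) x u * (g x (K a x) v * g x (K b x) w)
      + γ x a b * ((g x (covD g (K a) x u) v + g x (K a x) (covD g V x u)) * g x (K b x) w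
        + g x (K a x) v * (g x (covD g (K b) x u) w + g x (K b x) (covD g W x u)))) =
      ∑ a, ∑ b, (mvfderiv (𝓡 m) (fun y ↦ γ y a b) x u * (g x (K a x) v * g x (K b x) w)
      + γ x a b * (g x (covD g (K a) x u) v * g x (K b x) w
        + g x (K a x) v * g x (covD g (K b) x u) w))
      + ∑ a, ∑ b, γ x a b * (g x (K a x) (covD g V x u) * g x (K b x) w)
      + ∑ a, ∑ b, γ x a b * (g x (K a x) v * g x (K b x) (covD g W x u)) := by
    simp only [← Finset.sum_add_distrib]
    exact Finset.sum_congr rfl fun a _ ↦ Finset.sum_congr rfl fun b _ ↦ by ring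
  have main : covDTensor g (F.liftedTensor K Ψt α γ) x u v w =
      mvfderiv (𝓡 m) (fun y ↦ F.liftedTensor K Ψt α γ y (V y) (W y)) x u
        - F.liftedTensor K Ψt α γ x (covD g V x u) w
        - F.liftedTensor K Ψt α γ x v (covD g W x u) := rfl
  rw [main, e, s8.mvfderiv_add s5, s1.mvfderiv_add s4, hα.mvfderiv_mul hVW, d4,
    hΨs.exp.mvfderiv_mul s7, hnV.mvfderiv_mul hnW, hΨs.mvfderiv_exp, hd hVs hWs,
    hd hns hVs, hd hns hWs, hVx, hWx, T, T, split, liftedTensorDeriv]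
  ring

theorem liftedTensorDeriv_add_left (Ψt α : M → ℝ) (γ : M → Matrix (Fin n) (Fin n) ℝ) (x : M)
    (u u' v w : TangentSpace (𝓡 m) x) :
    F.liftedTensorDeriv K Ψt α γ x (u + u') v w =
      F.liftedTensorDeriv K Ψt α γ x u v w + F.liftedTensorDeriv K Ψt α γ x u' v w := by
  simp only [liftedTensorDeriv, map_add, FunLike.coe_add, Pi.add_apply, mul_add, add_mul,
    Finset.sum_add_distrib]
  ring

theorem liftedTensorDeriv_add_middle (Ψt α : M → ℝ) (γ : M → Matrix (Fin n) (Fin n) ℝ) (x : M)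
    (u v v' w : TangentSpace (𝓡 m) x) :
    F.liftedTensorDeriv K Ψt α γ x u (v + v') w =
      F.liftedTensorDeriv K Ψt α γ x u v w + F.liftedTensorDeriv K Ψt α γ x u v' w := by
  simp only [liftedTensorDeriv, map_add, FunLike.coe_add, Pi.add_apply, mul_add, add_mul,
    Finset.sum_add_distrib]
  ring

theorem liftedTensorDeriv_symm (Ψt α : M → ℝ) {γ : M → Matrix (Fin n) (Fin n) ℝ} {x : M}
    (hγ : ∀ᶠ y in nhds x, (γ y).IsSymm) (u v w : TangentSpace (𝓡 m) x) :
    F.liftedTensorDeriv K Ψt α γ x u v w = F.liftedTensorDeriv K Ψt α γ x u w v := by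
  -- The derivatives of `γ` enter, so its symmetry is required near `x` and not only at `x`.
  have h1 : ∀ a b, mvfderiv (𝓡 m) (fun y ↦ γ y a b) x u =
      mvfderiv (𝓡 m) (fun y ↦ γ y b a) x u := fun a b ↦
    mvfderiv_congr (hγ.mono fun y hy ↦ (hy.apply a b).symm) u
  have h2 : ∀ a b, γ x a b = γ x b a := fun a b ↦ (hγ.self_of_nhds.apply a b).symm
  simp only [liftedTensorDeriv]
  rw [g.symm x v w, Finset.sum_comm]
  congr 1
  · congr 1
    refine Finset.sum_congr rfl fun a _ ↦ Finset.sum_congr rfl fun b _ ↦ ?_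
    rw [h1 b a, h2 b a]
    ring
  · ring

theorem mvfderiv_decomp (f : M → ℝ) (x : M) (u : TangentSpace (𝓡 m) x) :
    mvfderiv (𝓡 m) f x u = F.tanD f x u + F.ε * g x (F.normal x) u * F.normalD f x := by
  rw [tanD, normalD, proj_apply, map_sub, map_smul, smul_eq_mul]
  ring

/-- The heart of the Killing property: each derivative along `u` is split into tangential and normal
parts, and the coefficients of `t`, `t²` and `t³` cancel separately. -/
theorem liftedTensorDeriv_diag (hK : ∀ a, IsKillingField g (K a))
    (hKtan : ∀ a x, g x (F.normal x) (K a x) = 0) (hG : ∀ x, IsUnit (gram g K x).det)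
    (hblock : ∀ x a X, F.IsComplementary K x X → F.secondForm x (K a x) X = 0)
    (humb : ∀ x X Y, F.IsComplementary K x X → F.IsComplementary K x Y →
      F.secondForm x X Y = F.chi K x * g x X Y)
    {U : Set M} (hU : IsOpen U) {Ψt α : M → ℝ} {γ ν : M → Matrix (Fin n) (Fin n) ℝ}
    (hsol : F.IsSolutionOn K U Ψt α γ ν) {x : M} (hx : x ∈ U) (u : TangentSpace (𝓡 m) x) :
    F.liftedTensorDeriv K Ψt α γ x u u u = 0 := by
  have hUx : U ∈ nhds x := hU.mem_nhds hx
  have hΨt : SmoothAt m Ψt x := hsol.smooth_Ψt.contMDiffAt hUx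
  have hν : ∀ a b, SmoothAt m (fun y ↦ ν y a b) x := fun a b ↦ (hsol.smooth_ν a b).contMDiffAt hUx
  have hΨ := F.smoothAt_psi hΨt
  have hGs := smoothAt_gramInv g hK hG x
  set t := g x (F.normal x) u with ht
  set v := F.proj x u with hv
  have hnv : g x (F.normal x) v = 0 := F.normal_proj x u
  have hu : u = v + (F.ε * t) • F.normal x := by rw [hv, proj_apply]; abel
  have hKu : ∀ a, g x (K a x) u = g x (K a x) v := by
    intro a
    rw [hu, map_add, map_smul, g.symm x (K a x) (F.normal x), hKtan, smul_zero, add_zero]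
  have hguu : g x u u = g x v v + F.ε * t ^ 2 := by
    rw [hu]
    simp only [map_add, map_smul, FunLike.coe_add, FunLike.coe_smul, Pi.add_apply, Pi.smul_apply,
      smul_eq_mul, normal_self, hnv, g.symm x v (F.normal x)]
    linear_combination F.ε * t ^ 2 * F.ε_mul_self
  have hα : mvfderiv (𝓡 m) α x u = -2 * t * F.chi K x * Real.exp (F.psi Ψt x) := by
    rw [F.mvfderiv_decomp, hsol.tanD_α x hx, hsol.normalD_α x hx]
    linear_combination -2 * t * F.chi K x * Real.exp (F.psi Ψt x) * F.ε_mul_self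
  -- The summand `ln φ²` of `Ψ` absorbs the term `-2 n ln φ` in the equation for `Ψ̃`.
  have hΨn : F.normalD (F.psi Ψt) x = 2 * F.chi K x := by
    have := hsol.normalD_Ψt x hx
    simp only [normalD] at this ⊢
    rw [mvfderiv_psi F hΨt, this]
    ring
  have hΨu : mvfderiv (𝓡 m) (F.psi Ψt) x u =
      2 * mvfderiv (𝓡 m) (fun y ↦ Real.log (F.lapse y)) x v + 2 * F.ε * t * F.chi K x := by
    have h1 := hsol.tanD_Ψt x hx u
    rw [F.mvfderiv_decomp, hΨn]
    simp only [tanD] at h1 ⊢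
    rw [mvfderiv_psi F hΨt, h1]
    ring
  have hγu : ∀ a b, mvfderiv (𝓡 m) (fun y ↦ γ y a b) x u = t * Real.exp (F.psi Ψt x) *
      (2 * F.chi K x * gramInv g K x a b + F.normalD (fun y ↦ gramInv g K y a b) x) := by
    intro a b
    have h1 : F.normalD (fun y ↦ γ y a b) x = F.ε * (Real.exp (F.psi Ψt x) *
        (2 * F.chi K x * gramInv g K x a b + F.normalD (fun y ↦ gramInv g K y a b) x)) := by
      have e : (fun y ↦ γ y a b) =ᶠ[nhds x] fun y ↦
          F.ε * (Real.exp (F.psi Ψt y) * gramInv g K y a b) + ν y a b := by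
        filter_upwards [hUx] with y hy
        rw [hsol.γ_eq y hy, mul_assoc]
      have s1 : SmoothAt m (fun y ↦ Real.exp (F.psi Ψt y) * gramInv g K y a b) x :=
        hΨ.exp.mul (hGs a b)
      have s2 : SmoothAt m (fun y ↦ F.ε * (Real.exp (F.psi Ψt y) * gramInv g K y a b)) x :=
        contMDiffAt_const.mul s1
      have h2 := hsol.normalD_ν a b x hx
      simp only [normalD] at h2 hΨn ⊢
      rw [mvfderiv_congr e, s2.mvfderiv_add (hν a b), s1.mvfderiv_const_mul,
        hΨ.exp.mvfderiv_mul (hGs a b), hΨ.mvfderiv_exp, h2, hΨn]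
      ring
    rw [F.mvfderiv_decomp, hsol.tanD_γ a b x hx, h1]
    linear_combination t * Real.exp (F.psi Ψt x) *
      (2 * F.chi K x * gramInv g K x a b + F.normalD (fun y ↦ gramInv g K y a b) x) *
      F.ε_mul_self
  have hcov : g x (covD g F.normal x u) u =
      F.secondForm x v v - t * mvfderiv (𝓡 m) (fun y ↦ Real.log (F.lapse y)) x v := by
    have h1 : g x (covD g F.normal x u) u = g x (covD g F.normal x u) v := by
      conv_lhs => rw [hu]
      rw [map_add, map_smul, ← hu, covD_normal_normal]
      simp
    rw [h1, F.secondForm_of_tangent hnv hnv]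
    conv_lhs => rw [hu]
    simp only [map_add, map_smul, FunLike.coe_add, FunLike.coe_smul, Pi.add_apply, Pi.smul_apply,
      smul_eq_mul, covD_normal_along_normal, hnv]
    linear_combination -t * mvfderiv (𝓡 m) (fun y ↦ Real.log (F.lapse y)) x v * F.ε_mul_self
  have hkill : ∀ a, g x (covD g (K a) x u) u = 0 := fun a ↦ by
    have := (hK a).killing x u u
    linarith
  have hsum : ∑ a, ∑ b, mvfderiv (𝓡 m) (fun y ↦ γ y a b) x u * (g x (K a x) v * g x (K b x) v) =
      t * Real.exp (F.psi Ψt x) * (2 * F.chi K x *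
        (∑ a, ∑ b, gramInv g K x a b * g x (K a x) v * g x (K b x) v) -
        2 * F.secondForm x (spanProj g K x v) (spanProj g K x v)) := by
    have h1 := F.sum_normalD_gramInv hK hKtan hG x v
    rw [sub_eq_add_neg, ← neg_mul, ← h1]
    simp only [Finset.mul_sum, ← Finset.sum_add_distrib, hγu]
    exact Finset.sum_congr rfl fun a _ ↦ Finset.sum_congr rfl fun b _ ↦ by ring
  simp only [liftedTensorDeriv, hkill, hKu, zero_mul, mul_zero, add_zero]
  rw [hsum, hα, hΨu, hcov, hguu, ← ht, F.secondForm_self hKtan hG hblock humb x hnv]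
  ring

end Foliation

/-! ### Smoothness, Killing equation and slice-reducibility of the lifted tensor -/

namespace Foliation

variable {g : LorentzianMetric m M} (F : Foliation g) {n : ℕ}
  {K : Fin n → (y : M) → TangentSpace (𝓡 m) y}

set_option synthInstance.maxHeartbeats 200000 in
theorem contMDiffAt_liftedTensor (hK : ∀ a, IsKillingField g (K a)) {Ψt α : M → ℝ}
    {γ : M → Matrix (Fin n) (Fin n) ℝ} {x : M} (hΨ : SmoothAt m Ψt x) (hα : SmoothAt m α x)
    (hγ : ∀ a b, SmoothAt m (fun y ↦ γ y a b) x) :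
    ContMDiffAt (𝓡 m)
      ((𝓡 m).prod 𝓘(ℝ, EuclideanSpace ℝ (Fin m) →L[ℝ] EuclideanSpace ℝ (Fin m) →L[ℝ] ℝ)) ∞
      (fun y ↦ Bundle.TotalSpace.mk'
        (EuclideanSpace ℝ (Fin m) →L[ℝ] EuclideanSpace ℝ (Fin m) →L[ℝ] ℝ)
        (E := fun y ↦ TangentSpace (𝓡 m) y →L[ℝ] TangentSpace (𝓡 m) y →L[ℝ] ℝ) y
        (F.liftedTensor K Ψt α γ y)) x := by
  have hKs := fun a ↦ (hK a).smoothFieldAt x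
  have hns := F.smoothFieldAt_normal x
  have h1 := ContMDiffAt.smul_section hα (g.contMDiff x)
  have h2 := ContMDiffAt.sum_section (s := Finset.univ) fun a _ ↦
    ContMDiffAt.sum_section (s := Finset.univ) fun b _ ↦
      (hγ a b).smul_section (g.contMDiffAt_smulRight (hKs a) (hKs b))
  have h3 := (F.smoothAt_psi hΨ).exp.smul_section (g.contMDiffAt_smulRight hns hns)
  exact (h1.add_section h2).add_section h3

theorem isKillingTensorOn_liftedTensor (hK : ∀ a, IsKillingField g (K a))
    (hKtan : ∀ a x, g x (F.normal x) (K a x) = 0) (hG : ∀ x, IsUnit (gram g K x).det)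
    (hblock : ∀ x a X, F.IsComplementary K x X → F.secondForm x (K a x) X = 0)
    (humb : ∀ x X Y, F.IsComplementary K x X → F.IsComplementary K x Y →
      F.secondForm x X Y = F.chi K x * g x X Y)
    {U : Set M} (hU : IsOpen U) {Ψt α : M → ℝ} {γ ν : M → Matrix (Fin n) (Fin n) ℝ}
    (hsol : F.IsSolutionOn K U Ψt α γ ν) :
    IsKillingTensorOn g U (F.liftedTensor K Ψt α γ) := by
  have hΨ : ∀ x ∈ U, SmoothAt m Ψt x := fun x hx ↦ hsol.smooth_Ψt.contMDiffAt (hU.mem_nhds hx)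
  have hα : ∀ x ∈ U, SmoothAt m α x := fun x hx ↦ hsol.smooth_α.contMDiffAt (hU.mem_nhds hx)
  have hγ : ∀ x ∈ U, ∀ a b, SmoothAt m (fun y ↦ γ y a b) x := fun x hx a b ↦
    (hsol.smooth_γ a b).contMDiffAt (hU.mem_nhds hx)
  refine ⟨fun x hx ↦ (F.contMDiffAt_liftedTensor hK (hΨ x hx) (hα x hx)
    (hγ x hx)).contMDiffWithinAt, fun x hx v w ↦ ?_, fun x hx u v w ↦ ?_⟩
  · have h : ∀ a b, γ x a b = γ x b a := fun a b ↦ ((hsol.γ_symm x hx).apply a b).symm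
    simp only [liftedTensor, FunLike.coe_add, FunLike.coe_sum, FunLike.coe_smul, Pi.add_apply,
      Finset.sum_apply, Pi.smul_apply, ContinuousLinearMap.smulRight_apply, smul_eq_mul]
    rw [g.symm x v w, Finset.sum_comm]
    congr 1
    · congr 1
      refine Finset.sum_congr rfl fun a _ ↦ Finset.sum_congr rfl fun b _ ↦ ?_
      rw [h b a]
      ring
    · ring
  · simp only [F.covDTensor_liftedTensor hK (hΨ x hx) (hα x hx) (hγ x hx)]
    exact cyclic_sum_eq_zero_of_diag (F.liftedTensorDeriv_add_left Ψt α γ x)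
      (F.liftedTensorDeriv_add_middle Ψt α γ x)
      (F.liftedTensorDeriv_symm Ψt α (Filter.eventually_of_mem (hU.mem_nhds hx) hsol.γ_symm))
      (F.liftedTensorDeriv_diag hK hKtan hG hblock humb hU hsol hx) u v w

/-- Projection removes the `n n` term. The `K_a` themselves serve as the Killing fields of the
slices, with `a = α` and `c = γ`. -/
theorem isSliceReducibleOn_liftedTensor (hK : ∀ a, IsKillingField g (K a))
    (hKtan : ∀ a x, g x (F.normal x) (K a x) = 0)
    {U : Set M} {Ψt α : M → ℝ} {γ ν : M → Matrix (Fin n) (Fin n) ℝ}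
    (hsol : F.IsSolutionOn K U Ψt α γ ν) :
    F.IsSliceReducibleOn U (F.liftedTensor K Ψt α γ) := by
  refine ⟨n, K, α, γ, fun a ↦ ⟨(hK a).smooth.mono (subset_univ U), fun x _ ↦ hKtan a x,
    fun x _ v w ↦ (hK a).killing x _ _⟩, hsol.smooth_α, hsol.smooth_γ, hsol.γ_symm, hsol.tanD_α,
    hsol.tanD_γ, fun x _ v w ↦ ?_⟩
  simp [liftedTensor, normal_proj, mul_assoc]

end Foliation

/-! ## Straightening a submersion to the line -/

/-- Adding to the identity the nonlinear remainder of `f`, in a direction `v` on which the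
derivative `ℓ` equals `1`, gives a map `G` with `ℓ(G z - p) = f z - f p`. The remainder has zero
derivative at `p`, so `G` has identity derivative there and the inverse function theorem applies. -/
theorem exists_openPartialHomeomorph_straightening {E : Type*} [NormedAddCommGroup E]
    [NormedSpace ℝ E] [CompleteSpace E] {f : E → ℝ} {p v : E} (hf : ContDiffAt ℝ ∞ f p)
    (hv : fderiv ℝ f p v = 1) :
    ∃ e : OpenPartialHomeomorph E E, p ∈ e.source ∧ e p = p ∧ ContDiffAt ℝ ∞ e.symm p ∧
      ∀ y ∈ e.target, f (e.symm y) = f p + fderiv ℝ f p (y - p) := by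
  set ℓ := fderiv ℝ f p with hℓ
  let G : E → E := fun z ↦ z + (f z - f p - ℓ (z - p)) • v
  have hG : ContDiffAt ℝ ∞ G p :=
    contDiffAt_id.add (((hf.sub contDiffAt_const).sub
      (ℓ.contDiff.contDiffAt.comp p (contDiffAt_id.sub contDiffAt_const))).smul contDiffAt_const)
  have hGp : G p = p := by simp [G]
  have hG' : HasFDerivAt G (ContinuousLinearEquiv.refl ℝ E : E →L[ℝ] E) p := by
    have h1 : HasFDerivAt f ℓ p := (hf.differentiableAt (by simp)).hasFDerivAt
    have h2 : HasFDerivAt (fun z ↦ ℓ (z - p)) ℓ p :=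
      ℓ.hasFDerivAt.comp p ((hasFDerivAt_id p).sub_const p)
    have h3 := (hasFDerivAt_id p).add (((h1.sub_const (f p)).sub h2).smul_const v)
    refine h3.congr_fderiv ?_
    ext z
    simp
  refine ⟨hG.toOpenPartialHomeomorph G hG' (by simp),
    hG.mem_toOpenPartialHomeomorph_source hG' (by simp), hGp, ?_, fun y hy ↦ ?_⟩
  · have := hG.to_localInverse hG' (by simp)
    rwa [hGp] at this
  · have h := (hG.toOpenPartialHomeomorph G hG' (by simp)).right_inv hy
    rw [ContDiffAt.toOpenPartialHomeomorph_coe] at h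
    set z := (hG.toOpenPartialHomeomorph G hG' (by simp)).symm y
    have h2 := congrArg ℓ h
    simp only [G, map_add, map_smul, hv, smul_eq_mul, map_sub] at h2
    rw [map_sub]
    linarith

theorem exists_straightening {f : M → ℝ} {x : M} (hf : SmoothAt m f x)
    (hd : ∃ w, mvfderiv (𝓡 m) f x w ≠ 0) {N : Set M} (hN : N ∈ nhds x) :
    ∃ (q : EuclideanSpace ℝ (Fin m) → M) (ℓ : EuclideanSpace ℝ (Fin m) →L[ℝ] ℝ)
      (v : EuclideanSpace ℝ (Fin m)) (δ : ℝ), 0 < δ ∧ ℓ v = 1 ∧ q 0 = x ∧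
      ContMDiffAt 𝓘(ℝ, EuclideanSpace ℝ (Fin m)) (𝓡 m) ∞ q 0 ∧
      (∀ z ∈ Metric.ball 0 δ,
        MDifferentiableAt 𝓘(ℝ, EuclideanSpace ℝ (Fin m)) (𝓡 m) q z) ∧
      (∀ z ∈ Metric.ball 0 δ, f (q z) = f x + ℓ z) ∧
      IsOpen (q '' Metric.ball 0 δ) ∧ q '' Metric.ball 0 δ ⊆ N := by
  obtain ⟨w, hw⟩ := hd
  set c := chartAt (EuclideanSpace ℝ (Fin m)) x with hc
  set p := c x with hp
  have hxc : x ∈ c.source := mem_chart_source _ x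
  have hcp : c.symm p = x := c.left_inv hxc
  have hfs : ContDiffAt ℝ ∞ (f ∘ c.symm) p := by simpa using hf.contDiffAt_chart
  rw [mvfderiv_eq_fderiv_chart hf.mdifferentiableAt] at hw
  obtain ⟨v, hv⟩ : ∃ v, fderiv ℝ (f ∘ c.symm) p v = 1 := by
    let a : ℝ := fderiv ℝ (f ∘ c.symm) p w
    have ha : a ≠ 0 := by simpa using hw
    refine ⟨a⁻¹ • (show EuclideanSpace ℝ (Fin m) from w), ?_⟩
    rw [map_smul]
    exact inv_mul_cancel₀ ha
  obtain ⟨e, hpe, hep, hes, hef⟩ := exists_openPartialHomeomorph_straightening hfs hv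
  set ψ := (c.trans e).symm with hψ
  have hpψ : p ∈ ψ.source := by
    have : x ∈ (c.trans e).source := by simp [hxc, hpe, ← hp]
    have := (c.trans e).map_source this
    rw [OpenPartialHomeomorph.trans_apply, ← hp, hep] at this
    exact this
  have hsrc : ∀ y ∈ ψ.source, y ∈ e.target ∧ e.symm y ∈ c.target := by
    intro y hy
    simpa [hψ, OpenPartialHomeomorph.trans_target] using hy
  have hesp : e.symm p = p := by
    have := e.left_inv hpe
    rwa [hep] at this
  have hψp : ψ p = x := by
    simp [hψ, hesp, hcp]
  have hcs : ∀ y ∈ c.target, ContMDiffAt (𝓡 m) (𝓡 m) ∞ c.symm y := fun y hy ↦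
    contMDiffOn_chart_symm.contMDiffAt (c.open_target.mem_nhds hy)
  -- Smoothness of infinite order at a point gives each finite order only on a neighbourhood
  -- depending on that order. Order one suffices on the ball; full smoothness is kept at the centre.
  have hev : ∀ᶠ y in nhds p, ContDiffAt ℝ 1 e.symm y :=
    (hes.of_le (by simp)).eventually (by simp)
  have hN' : ∀ᶠ y in nhds p, ψ y ∈ N := by
    have := ψ.continuousAt hpψ
    rw [ContinuousAt, hψp] at this
    exact this.eventually hN
  obtain ⟨δ, hδ, hball⟩ := Metric.eventually_nhds_iff_ball.1
    ((hev.and hN').and (ψ.open_source.eventually_mem hpψ))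
  have hmem : ∀ z ∈ Metric.ball (0 : EuclideanSpace ℝ (Fin m)) δ, p + z ∈ Metric.ball p δ := by
    intro z hz
    simpa [mem_ball_iff_norm] using hz
  have hd' : ∀ k : WithTop ℕ∞, ∀ z, k ≤ ∞ → ContDiffAt ℝ k e.symm (p + z) → p + z ∈ ψ.source →
      ContMDiffAt 𝓘(ℝ, EuclideanSpace ℝ (Fin m)) (𝓡 m) k (fun z ↦ ψ (p + z)) z := by
    intro k z hk h1 h2
    have h3 : ContMDiffAt 𝓘(ℝ, EuclideanSpace ℝ (Fin m)) (𝓡 m) k (fun z ↦ e.symm (p + z)) z :=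
      (h1.comp z (contDiffAt_const.add contDiffAt_id)).contMDiffAt
    exact ContMDiffAt.comp (g := c.symm) (f := fun z ↦ e.symm (p + z)) z
      ((hcs _ (hsrc _ h2).2).of_le hk) h3
  refine ⟨fun z ↦ ψ (p + z), fderiv ℝ (f ∘ c.symm) p, v, δ, hδ, hv, by simpa using hψp, ?_, ?_, ?_,
    ?_, ?_⟩
  · refine hd' ∞ 0 le_rfl (by simpa using hes) (by simpa using hpψ)
  · intro z hz
    obtain ⟨⟨h1, -⟩, h2⟩ := hball _ (hmem z hz)
    exact (hd' 1 z (by simp) h1 h2).mdifferentiableAt (by simp)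
  · intro z hz
    have h2 := (hball _ (hmem z hz)).2
    have h3 := hef _ (hsrc _ h2).1
    simpa [hψ, hcp] using h3
  · have : (fun z ↦ ψ (p + z)) '' Metric.ball 0 δ = ψ '' Metric.ball p δ := by
      rw [← image_image (g := ψ) (f := fun z ↦ p + z)]
      simp
    rw [this]
    exact ψ.isOpen_image_of_subset_source Metric.isOpen_ball fun y hy ↦ (hball y hy).2
  · rintro _ ⟨z, hz, rfl⟩
    exact (hball _ (hmem z hz)).1.2

/-! ## Functions constant along the slices -/

theorem exists_primitive {V : Set ℝ} (hV : IsOpen V) {r : ℝ → ℝ}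
    (hr : ∀ t ∈ V, ContDiffAt ℝ ∞ r t) :
    ∃ p : ℝ → ℝ, (∀ t ∈ V, ContDiffAt ℝ ∞ p t) ∧ ∀ t ∈ V, HasDerivAt p (r t) t := by
  classical
  -- `V` may be disconnected, so each component has its own base point for the integral. It depends
  -- only on the component, hence is locally constant in the endpoint.
  let b : Set ℝ → ℝ := fun C ↦ if h : C.Nonempty then h.some else 0
  have hc : ContinuousOn r V := fun t ht ↦ (hr t ht).continuousAt.continuousWithinAt
  have key : ∀ t ∈ V, HasDerivAt (fun t ↦ ∫ s in (b (connectedComponentIn V t))..t, r s) (r t) t := by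
    intro t ht
    set C := connectedComponentIn V t with hC
    have hCo : IsOpen C := hV.connectedComponentIn
    have htC : t ∈ C := mem_connectedComponentIn ht
    have hbC : b C ∈ C := by
      have : C.Nonempty := ⟨t, htC⟩
      simp only [b, dif_pos this]
      exact this.some_mem
    have hsub : uIcc (b C) t ⊆ V :=
      (isPreconnected_connectedComponentIn.ordConnected.uIcc_subset hbC htC).trans
        (connectedComponentIn_subset V t)
    have h1 : HasDerivAt (fun u ↦ ∫ s in (b C)..u, r s) (r t) t :=
      intervalIntegral.integral_hasDerivAt_right (hc.mono hsub).intervalIntegrable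
        (hc.stronglyMeasurableAtFilter hV t ht) (hr t ht).continuousAt
    refine h1.congr_of_eventuallyEq ?_
    filter_upwards [hCo.mem_nhds htC] with u hu
    rw [← connectedComponentIn_eq hu]
  refine ⟨_, fun t ht ↦ ?_, key⟩
  refine ContDiffOn.contDiffAt ?_ (hV.mem_nhds ht)
  rw [contDiffOn_infty_iff_deriv_of_isOpen hV]
  refine ⟨fun u hu ↦ (key u hu).differentiableAt.differentiableWithinAt, ?_⟩
  exact ContDiffOn.congr (fun u hu ↦ (hr u hu).contDiffWithinAt) fun u hu ↦ (key u hu).deriv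

theorem hasFDerivAt_comp_curve {E : Type*} [NormedAddCommGroup E] [NormedSpace ℝ E] {f : M → ℝ}
    {q : E → M} {z : E} (hf : MDifferentiableAt (𝓡 m) 𝓘(ℝ, ℝ) f (q z))
    (hq : MDifferentiableAt 𝓘(ℝ, E) (𝓡 m) q z) :
    ∃ L : E →L[ℝ] ℝ, HasFDerivAt (fun z ↦ f (q z)) L z ∧
      ∀ k : E, L k = mvfderiv (𝓡 m) f (q z) (mfderiv 𝓘(ℝ, E) (𝓡 m) q z k) := by
  have h := hf.hasMFDerivAt.comp z hq.hasMFDerivAt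
  exact ⟨_, h.hasFDerivAt, fun k ↦ rfl⟩

namespace Foliation

variable {g : LorentzianMetric m M} (F : Foliation g)

theorem exists_mvfderiv_ne_zero (x : M) : ∃ w, mvfderiv (𝓡 m) F.Φ x w ≠ 0 := by
  refine ⟨F.normal x, ?_⟩
  have h := F.normalD_Φ x
  rw [normalD] at h
  rw [h]
  have hε : F.ε ≠ 0 := fun h0 ↦ by simpa [h0] using F.ε_mul_self
  have hσ : F.σ ≠ 0 := fun h0 ↦ by simpa [h0] using F.σ_mul_self
  exact mul_ne_zero (mul_ne_zero hσ hε) (inv_ne_zero (F.lapse_pos x).ne')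

/-- The segment from `z₁` to `z₂` stays in the ball and in a level set of `ℓ`. Its image has
velocity tangent to the slices, so `W` has zero derivative along it. -/
theorem eq_of_tanD_eq_zero {q : EuclideanSpace ℝ (Fin m) → M}
    {ℓ : EuclideanSpace ℝ (Fin m) →L[ℝ] ℝ} {δ c : ℝ}
    (hq : ∀ z ∈ Metric.ball 0 δ,
      MDifferentiableAt 𝓘(ℝ, EuclideanSpace ℝ (Fin m)) (𝓡 m) q z)
    (hΦ : ∀ z ∈ Metric.ball 0 δ, F.Φ (q z) = c + ℓ z) {W : M → ℝ}
    (hW : ∀ z ∈ Metric.ball 0 δ, MDifferentiableAt (𝓡 m) 𝓘(ℝ, ℝ) W (q z))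
    (hW0 : ∀ z ∈ Metric.ball 0 δ, ∀ v, F.tanD W (q z) v = 0)
    {z₁ z₂ : EuclideanSpace ℝ (Fin m)} (h₁ : z₁ ∈ Metric.ball 0 δ) (h₂ : z₂ ∈ Metric.ball 0 δ)
    (h : ℓ z₁ = ℓ z₂) : W (q z₁) = W (q z₂) := by
  have hmem : ∀ s ∈ Icc (0 : ℝ) 1, AffineMap.lineMap z₁ z₂ s ∈ Metric.ball 0 δ := fun s hs ↦
    (convex_ball 0 δ).lineMap_mem h₁ h₂ hs
  have hder : ∀ s ∈ Icc (0 : ℝ) 1,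
      HasDerivAt (fun s ↦ W (q (AffineMap.lineMap z₁ z₂ s))) 0 s := by
    intro s hs
    have hz := hmem s hs
    set z := AffineMap.lineMap z₁ z₂ s with hzs
    obtain ⟨L, hL, hLk⟩ := hasFDerivAt_comp_curve (hW z hz) (hq z hz)
    obtain ⟨L', hL', hLk'⟩ :=
      hasFDerivAt_comp_curve (F.smoothAt_Φ (q z)).mdifferentiableAt (hq z hz)
    have e : L' = ℓ := by
      refine hL'.unique ((ℓ.hasFDerivAt.const_add c).congr_of_eventuallyEq ?_)
      filter_upwards [Metric.isOpen_ball.mem_nhds hz] with y hy using hΦ y hy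
    have h0 : L (z₂ - z₁) = 0 := by
      have h3 := hLk' (z₂ - z₁)
      rw [e, map_sub, h, sub_self] at h3
      have h4 := hW0 z hz (mfderiv 𝓘(ℝ, EuclideanSpace ℝ (Fin m)) (𝓡 m) q z (z₂ - z₁))
      rw [tanD, F.proj_of_tangent (by rw [normal_apply, ← h3, mul_zero])] at h4
      rw [hLk, h4]
    have := hL.comp_hasDerivAt s (AffineMap.hasDerivAt_lineMap (a := z₁) (b := z₂) (x := s))
    rwa [h0] at this
  have := constant_of_has_deriv_right_zero
    (fun s hs ↦ (hder s hs).continuousAt.continuousWithinAt)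
    (fun s hs ↦ (hder s (Ico_subset_Icc_self hs)).hasDerivWithinAt) 1 (by simp)
  simpa using this.symm

/-- Straightening makes `W` locally constant on the slice, and connectedness makes it constant. -/
theorem eq_of_isPreconnected {U : Set M} (hU : IsOpen U) {s : ℝ}
    (hs : IsPreconnected (U ∩ F.slice s)) {W : M → ℝ} (hW : ∀ x ∈ U, SmoothAt m W x)
    (hW0 : ∀ x ∈ U, ∀ v, F.tanD W x v = 0) {x y : M} (hx : x ∈ U ∩ F.slice s)
    (hy : y ∈ U ∩ F.slice s) : W x = W y := by
  have := isPreconnected_iff_preconnectedSpace.1 hs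
  have hl : IsLocallyConstant (fun x : ↥(U ∩ F.slice s) ↦ W x) := by
    rw [IsLocallyConstant.iff_eventually_eq]
    rintro ⟨x, hxU, hxs⟩
    obtain ⟨q, ℓ, v, δ, hδ, -, hq0, -, hq, hΦ, ho, hsub⟩ := exists_straightening (F.smoothAt_Φ x)
      (F.exists_mvfderiv_ne_zero x) (hU.mem_nhds hxU)
    have hx' : x ∈ q '' Metric.ball 0 δ := ⟨0, by simpa using hδ, hq0⟩
    have h1 := continuous_subtype_val.continuousAt (x := (⟨x, hxU, hxs⟩ : ↥(U ∩ F.slice s)))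
      |>.eventually (ho.mem_nhds hx')
    filter_upwards [h1] with ⟨y, hyU, hys⟩ hy
    obtain ⟨z, hz, rfl : q z = y⟩ := hy
    have hin : ∀ z ∈ Metric.ball 0 δ, q z ∈ U := fun z hz ↦ hsub ⟨z, hz, rfl⟩
    have h2 := F.eq_of_tanD_eq_zero hq hΦ
      (fun z hz ↦ (hW _ (hin z hz)).mdifferentiableAt) (fun z hz ↦ hW0 _ (hin z hz)) hz
      (Metric.mem_ball_self hδ) (by
        have h3 := hΦ z hz
        have h4 : F.Φ (q z) = s := hys
        have h5 : F.Φ x = s := hxs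
        rw [map_zero]
        linarith)
    simpa [hq0] using h2
  exact hl.apply_eq_of_preconnectedSpace ⟨x, hx⟩ ⟨y, hy⟩

/-- A function constant along the slices factors through `Φ`, and the factor has a primitive. -/
theorem exists_primitive_along {U : Set M} (hU : IsOpen U)
    (hs : ∀ s, IsPreconnected (U ∩ F.slice s)) {W : M → ℝ} (hW : ∀ x ∈ U, SmoothAt m W x)
    (hW0 : ∀ x ∈ U, ∀ v, F.tanD W x v = 0) :
    ∃ p : ℝ → ℝ, (∀ x ∈ U, ContDiffAt ℝ ∞ p (F.Φ x)) ∧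
      ∀ x ∈ U, HasDerivAt p (W x) (F.Φ x) := by
  classical
  -- The chosen point is irrelevant, as `W` is constant on each slice of `U`. The value `0` occurs
  -- only outside `Φ(U)`.
  let r : ℝ → ℝ := fun t ↦ if h : ∃ y ∈ U, F.Φ y = t then W h.choose else 0
  have hr : ∀ y ∈ U, r (F.Φ y) = W y := by
    intro y hy
    have h : ∃ z ∈ U, F.Φ z = F.Φ y := ⟨y, hy, rfl⟩
    simp only [r, dif_pos h]
    exact F.eq_of_isPreconnected hU (hs (F.Φ y)) hW hW0 ⟨h.choose_spec.1, h.choose_spec.2⟩ ⟨hy, rfl⟩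
  have hloc : ∀ x ∈ U, F.Φ '' U ∈ nhds (F.Φ x) ∧ ContDiffAt ℝ ∞ r (F.Φ x) := by
    intro x hx
    obtain ⟨q, ℓ, v, δ, hδ, hv, hq0, hqs, -, hΦ, -, hsub⟩ := exists_straightening (F.smoothAt_Φ x)
      (F.exists_mvfderiv_ne_zero x) (hU.mem_nhds hx)
    -- A curve transverse to the slices and parametrized by the value of `Φ`. Restricting `W` to it
    -- shows that `r` is smooth, and the curve itself shows that `Φ(U)` is open.
    let c : ℝ → EuclideanSpace ℝ (Fin m) := fun t ↦ (t - F.Φ x) • v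
    have hc : ContDiff ℝ ∞ c := (contDiff_id.sub contDiff_const).smul contDiff_const
    have hc0 : c (F.Φ x) = 0 := by simp [c]
    have hev : ∀ᶠ t in nhds (F.Φ x), c t ∈ Metric.ball 0 δ := by
      refine hc.continuous.continuousAt.eventually (Metric.isOpen_ball.mem_nhds ?_)
      simpa [hc0] using hδ
    have hΦc : ∀ᶠ t in nhds (F.Φ x), q (c t) ∈ U ∧ F.Φ (q (c t)) = t := by
      filter_upwards [hev] with t ht
      refine ⟨hsub ⟨_, ht, rfl⟩, ?_⟩
      rw [hΦ _ ht]
      simp [c, hv]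
    refine ⟨hΦc.mono fun t ht ↦ ⟨_, ht⟩, ?_⟩
    have h1 : ContMDiffAt 𝓘(ℝ, ℝ) (𝓡 m) ∞ (fun t ↦ q (c t)) (F.Φ x) :=
      ContMDiffAt.comp (g := q) (f := c) _ (by rwa [hc0]) hc.contDiffAt.contMDiffAt
    have h2 : ContMDiffAt 𝓘(ℝ, ℝ) 𝓘(ℝ, ℝ) ∞ (fun t ↦ W (q (c t))) (F.Φ x) :=
      ContMDiffAt.comp (g := W) (f := fun t ↦ q (c t)) _ (by rw [hc0, hq0]; exact hW x hx) h1
    refine h2.contDiffAt.congr_of_eventuallyEq ?_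
    filter_upwards [hΦc] with t ht
    rw [← hr _ ht.1, ht.2]
  have hV : IsOpen (F.Φ '' U) := isOpen_iff_mem_nhds.2 (by
    rintro _ ⟨x, hx, rfl⟩
    exact (hloc x hx).1)
  obtain ⟨p, hp, hp'⟩ := exists_primitive hV (r := r) (by
    rintro _ ⟨x, hx, rfl⟩
    exact (hloc x hx).2)
  refine ⟨p, fun x hx ↦ hp _ ⟨x, hx, rfl⟩, fun x hx ↦ ?_⟩
  have := hp' _ ⟨x, hx, rfl⟩
  rwa [hr x hx] at this

end Foliation

/-! ## Solving the equations -/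

theorem SmoothAt.fun_mul {f h : M → ℝ} {x : M} (hf : SmoothAt m f x) (hh : SmoothAt m h x) :
    SmoothAt m (fun y ↦ f y * h y) x :=
  hf.mul hh

theorem SmoothAt.fun_add {f h : M → ℝ} {x : M} (hf : SmoothAt m f x) (hh : SmoothAt m h x) :
    SmoothAt m (fun y ↦ f y + h y) x :=
  hf.add hh

namespace Foliation

variable {g : LorentzianMetric m M} (F : Foliation g)

theorem smoothAt_comp_Φ {p : ℝ → ℝ} {x : M} (hp : ContDiffAt ℝ ∞ p (F.Φ x)) :
    SmoothAt m (fun y ↦ p (F.Φ y)) x :=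
  ContMDiffAt.comp (g := p) (f := F.Φ) x hp.contMDiffAt (F.smoothAt_Φ x)

theorem tanD_comp_Φ {p : ℝ → ℝ} {p' : ℝ} {x : M} (hp : HasDerivAt p p' (F.Φ x))
    (v : TangentSpace (𝓡 m) x) : F.tanD (fun y ↦ p (F.Φ y)) x v = 0 := by
  have h := F.normal_proj x v
  rw [normal_apply] at h
  have hσ : F.σ ≠ 0 := fun h0 ↦ by simpa [h0] using F.σ_mul_self
  rw [tanD, mvfderiv_comp_real hp (F.smoothAt_Φ x).mdifferentiableAt,
    (mul_eq_zero.1 h).resolve_left (mul_ne_zero hσ (F.lapse_pos x).ne'), mul_zero]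

theorem normalD_comp_Φ {p : ℝ → ℝ} {p' : ℝ} {x : M} (hp : HasDerivAt p p' (F.Φ x)) :
    F.normalD (fun y ↦ p (F.Φ y)) x = p' * (F.σ * F.ε * (F.lapse x)⁻¹) := by
  rw [normalD, mvfderiv_comp_real hp (F.smoothAt_Φ x).mdifferentiableAt, ← F.normalD_Φ, normalD]

theorem exp_psi (Ψt : M → ℝ) (x : M) :
    Real.exp (F.psi Ψt x) = F.lapse x ^ 2 * Real.exp (Ψt x) := by
  rw [psi, Real.exp_add, Real.exp_log (pow_pos (F.lapse_pos x) 2)]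

theorem tanD_mul_eq_zero {f h : M → ℝ} {x : M} (hf : SmoothAt m f x) (hh : SmoothAt m h x)
    {v : TangentSpace (𝓡 m) x} (hf0 : F.tanD f x v = 0) (hh0 : F.tanD h x v = 0) :
    F.tanD (fun y ↦ f y * h y) x v = 0 := by
  rw [tanD] at *
  rw [hf.mvfderiv_mul hh, hf0, hh0, mul_zero, mul_zero, add_zero]

theorem tanD_const (c : ℝ) (x : M) (v : TangentSpace (𝓡 m) x) :
    F.tanD (fun _ ↦ c) x v = 0 := by
  rw [tanD, mvfderiv_const]
  simp

theorem tanD_exp_eq_zero {f : M → ℝ} {x : M} (hf : SmoothAt m f x)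
    {v : TangentSpace (𝓡 m) x} (hf0 : F.tanD f x v = 0) :
    F.tanD (fun y ↦ Real.exp (f y)) x v = 0 := by
  rw [tanD] at *
  rw [hf.mvfderiv_exp, hf0, mul_zero]

theorem smoothAt_lapse_pow (k : ℕ) (x : M) : SmoothAt m (fun y ↦ F.lapse y ^ k) x :=
  (F.smoothAt_lapse x).pow k

theorem mvfderiv_lapse_pow_three (x : M) (v : TangentSpace (𝓡 m) x) :
    mvfderiv (𝓡 m) (fun y ↦ F.lapse y ^ 3) x v =
      F.lapse x ^ 3 * mvfderiv (𝓡 m) (fun y ↦ Real.log (F.lapse y ^ 3)) x v := by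
  have hl := (pow_pos (F.lapse_pos x) 3).ne'
  rw [mvfderiv_comp_real (f := fun y ↦ F.lapse y ^ 3) (Real.hasDerivAt_log hl)
      (F.smoothAt_lapse_pow 3 x).mdifferentiableAt,
    mul_inv_cancel_left₀ hl]

/-- The integrand of `γ` is constant along the slices, up to the factor `e^Ψ̃`. -/
theorem tanD_integrand_eq_zero {χ G : M → ℝ} {x : M} (hχ : SmoothAt m χ x) (hGs : SmoothAt m G x)
    {v : TangentSpace (𝓡 m) x} (h2 : F.tanD (fun y ↦ χ y * F.lapse y ^ 3) x v = 0)
    (h3 : χ x ≠ 0 → F.tanD (fun y ↦ G y + 1 / (2 * χ y) * F.normalD G y) x v = 0)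
    (h3' : χ x = 0 → F.tanD (F.normalD G) x v =
      - F.tanD (fun y ↦ Real.log (F.lapse y ^ 3)) x v * F.normalD G x) :
    F.tanD (fun y ↦ F.lapse y ^ 3 * (2 * χ y * G y + F.normalD G y)) x v = 0 := by
  have hl3 := F.smoothAt_lapse_pow 3 x
  have hA : SmoothAt m (fun y ↦ χ y * F.lapse y ^ 3) x := hχ.fun_mul hl3
  have hnG := SmoothAt.normalD F hGs
  have h2A : SmoothAt m (fun y ↦ 2 * (χ y * F.lapse y ^ 3)) x := contMDiffAt_const.mul hA
  -- Where `χ = 0`, the term `2χφ³ 𝒟G` vanishes and the replacement condition says exactly that `φ³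
  -- nG` has zero tangential derivative.
  by_cases h0 : χ x = 0
  · have e : (fun y ↦ F.lapse y ^ 3 * (2 * χ y * G y + F.normalD G y)) =
        fun y ↦ 2 * (χ y * F.lapse y ^ 3) * G y + F.lapse y ^ 3 * F.normalD G y := by
      funext y
      ring
    have h3' := h3' h0
    rw [tanD] at *
    rw [e, SmoothAt.mvfderiv_add (h2A.fun_mul hGs) (hl3.fun_mul hnG), h2A.mvfderiv_mul hGs,
      hl3.mvfderiv_mul hnG, hA.mvfderiv_const_mul, h2, h3', mvfderiv_lapse_pow_three, h0]
    rw [tanD]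
    ring
  · have hinv : SmoothAt m (fun y ↦ 1 / (2 * χ y)) x := by
      have h4 : SmoothAt m (fun y ↦ 2 * χ y) x := contMDiffAt_const.mul hχ
      simpa [one_div] using SmoothAt.inv h4 (mul_ne_zero two_ne_zero h0)
    -- Where `χ ≠ 0`, the integrand factors near `x` into two functions with zero tangential
    -- derivative at `x`.
    have e : (fun y ↦ F.lapse y ^ 3 * (2 * χ y * G y + F.normalD G y)) =ᶠ[nhds x]
        fun y ↦ 2 * (χ y * F.lapse y ^ 3) * (G y + 1 / (2 * χ y) * F.normalD G y) := by
      filter_upwards [hχ.continuousAt.eventually_ne h0] with y hy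
      field_simp
    rw [tanD, mvfderiv_congr e, ← tanD]
    refine F.tanD_mul_eq_zero h2A (hGs.fun_add (hinv.fun_mul hnG)) ?_ (h3 h0)
    rw [tanD] at *
    rw [hA.mvfderiv_const_mul, h2, mul_zero]

variable {n : ℕ} {K : Fin n → (y : M) → TangentSpace (𝓡 m) y}

theorem exists_isSolutionOn (hn : n + 2 ≤ m) (hK : ∀ a, IsKillingField g (K a))
    (hKtan : ∀ a x, g x (F.normal x) (K a x) = 0) (hG : ∀ x, IsUnit (gram g K x).det)
    (humb : ∀ x X Y, F.IsComplementary K x X → F.IsComplementary K x Y →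
      F.secondForm x X Y = F.chi K x * g x X Y)
    (h1 : ∀ x v, F.tanD (fun y ↦ F.lapse y * F.chi K y
      - F.lapse y * F.normalD (fun z ↦ Real.log (F.lapse z)) y) x v = 0)
    (h2 : ∀ x v, F.tanD (fun y ↦ F.chi K y * F.lapse y ^ 3) x v = 0)
    (h3 : ∀ x, F.chi K x ≠ 0 → ∀ a b v,
      F.tanD (fun y ↦ gramInv g K y a b + 1 / (2 * F.chi K y) *
        F.normalD (fun z ↦ gramInv g K z a b) y) x v = 0)
    (h3' : ∀ x, F.chi K x = 0 → ∀ a b v,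
      F.tanD (fun y ↦ F.normalD (fun z ↦ gramInv g K z a b) y) x v =
        - F.tanD (fun y ↦ Real.log (F.lapse y ^ 3)) x v *
          F.normalD (fun z ↦ gramInv g K z a b) x)
    {U : Set M} (hU : IsOpen U) (hs : ∀ s, IsPreconnected (U ∩ F.slice s)) :
    ∃ (Ψt α : M → ℝ) (γ ν : M → Matrix (Fin n) (Fin n) ℝ), F.IsSolutionOn K U Ψt α γ ν := by
  have hχ : ∀ x, SmoothAt m (F.chi K) x := F.smoothAt_chi hn hK hKtan hG humb
  have hGs : ∀ x a b, SmoothAt m (fun y ↦ gramInv g K y a b) x := smoothAt_gramInv g hK hG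
  have hnG := fun x a b ↦ SmoothAt.normalD F (hGs x a b)
  have hnl := fun x ↦ SmoothAt.normalD F (F.smoothAt_log_lapse x)
  have hW1 : ∀ x, SmoothAt m (fun y ↦ F.lapse y * F.chi K y
      - F.lapse y * F.normalD (fun z ↦ Real.log (F.lapse z)) y) x := fun x ↦
    ((F.smoothAt_lapse x).fun_mul (hχ x)).sub ((F.smoothAt_lapse x).fun_mul (hnl x))
  have hc : ∀ (c : ℝ) x, SmoothAt m (fun _ : M ↦ c) x := fun c x ↦ contMDiffAt_const
  -- The constants `2σε`, `-2σ` and `σ` in the three integrands come from dividing the normal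
  -- equations by `n(Φ) = σε/φ`.
  obtain ⟨p, hp, hp'⟩ := F.exists_primitive_along hU hs
    (fun x _ ↦ (hc (2 * F.σ * F.ε) x).fun_mul (hW1 x))
    (fun x _ v ↦ F.tanD_mul_eq_zero (hc _ x) (hW1 x) (F.tanD_const _ x v) (h1 x v))
  have hE : ∀ x ∈ U, SmoothAt m (fun y ↦ Real.exp (p (F.Φ y))) x := fun x hx ↦
    (F.smoothAt_comp_Φ (hp x hx)).exp
  have hE0 : ∀ x ∈ U, ∀ v, F.tanD (fun y ↦ Real.exp (p (F.Φ y))) x v = 0 := fun x hx v ↦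
    F.tanD_exp_eq_zero (F.smoothAt_comp_Φ (hp x hx)) (F.tanD_comp_Φ (hp' x hx) v)
  have hA : ∀ x, SmoothAt m (fun y ↦ F.chi K y * F.lapse y ^ 3) x := fun x ↦
    (hχ x).fun_mul (F.smoothAt_lapse_pow 3 x)
  obtain ⟨q, hq, hq'⟩ := F.exists_primitive_along hU hs
    (fun x hx ↦ ((hc (-2 * F.σ) x).fun_mul (hA x)).fun_mul (hE x hx))
    (fun x hx v ↦ F.tanD_mul_eq_zero ((hc _ x).fun_mul (hA x)) (hE x hx)
      (F.tanD_mul_eq_zero (hc _ x) (hA x) (F.tanD_const _ x v) (h2 x v)) (hE0 x hx v))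
  have hB : ∀ a b x, SmoothAt m (fun y ↦ F.lapse y ^ 3 * (2 * F.chi K y * gramInv g K y a b +
      F.normalD (fun z ↦ gramInv g K z a b) y)) x := fun a b x ↦
    (F.smoothAt_lapse_pow 3 x).fun_mul ((((hc 2 x).fun_mul (hχ x)).fun_mul (hGs x a b)).fun_add (hnG x a b))
  have hB0 : ∀ a b x v, F.tanD (fun y ↦ F.lapse y ^ 3 * (2 * F.chi K y * gramInv g K y a b +
      F.normalD (fun z ↦ gramInv g K z a b) y)) x v = 0 := fun a b x v ↦
    F.tanD_integrand_eq_zero (hχ x) (hGs x a b) (h2 x v) (fun h ↦ h3 x h a b v)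
      (fun h ↦ h3' x h a b v)
  have hr := fun a b ↦ F.exists_primitive_along hU hs
    (fun x hx ↦ ((hc F.σ x).fun_mul (hB a b x)).fun_mul (hE x hx))
    (fun x hx v ↦ F.tanD_mul_eq_zero ((hc _ x).fun_mul (hB a b x)) (hE x hx)
      (F.tanD_mul_eq_zero (hc _ x) (hB a b x) (F.tanD_const _ x v) (hB0 a b x v)) (hE0 x hx v))
  choose r hr hr' using hr
  have hGsymm : ∀ x a b, gramInv g K x b a = gramInv g K x a b := fun x a b ↦
    (gramInv_isSymm g K x).apply a b
  let Ψt : M → ℝ := fun x ↦ p (F.Φ x)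
  -- The primitives are chosen entry by entry and may differ by constants under transposition, so
  -- they are symmetrized. The derivative is unaffected since `𝒢^ab` is symmetric.
  let ρ : Fin n → Fin n → ℝ → ℝ := fun a b t ↦ (r a b t + r b a t) / 2
  have hρ : ∀ a b, ∀ x ∈ U, ContDiffAt ℝ ∞ (ρ a b) (F.Φ x) := fun a b x hx ↦
    ((hr a b x hx).add (hr b a x hx)).div_const 2
  have hρ' : ∀ a b, ∀ x ∈ U, HasDerivAt (ρ a b) (F.σ * (F.lapse x ^ 3 *
      (2 * F.chi K x * gramInv g K x a b + F.normalD (fun z ↦ gramInv g K z a b) x)) *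
      Real.exp (Ψt x)) (F.Φ x) := by
    intro a b x hx
    have h := ((hr' a b x hx).add (hr' b a x hx)).div_const 2
    have e : (fun z ↦ gramInv g K z b a) = fun z ↦ gramInv g K z a b := funext fun z ↦ hGsymm z a b
    rw [e, hGsymm x a b] at h
    refine h.congr_deriv ?_
    simp only [Ψt]
    ring
  have hΨ : ∀ x ∈ U, SmoothAt m Ψt x := fun x hx ↦ F.smoothAt_comp_Φ (hp x hx)
  have hγ : ∀ a b, ∀ x ∈ U, SmoothAt m (fun y ↦ ρ a b (F.Φ y)) x := fun a b x hx ↦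
    F.smoothAt_comp_Φ (hρ a b x hx)
  have hεE : ∀ a b, ∀ x ∈ U, SmoothAt m (fun y ↦ (-F.ε) *
      (Real.exp (F.psi Ψt y) * gramInv g K y a b)) x := fun a b x hx ↦
    (hc _ x).fun_mul ((F.smoothAt_psi (hΨ x hx)).exp.fun_mul (hGs x a b))
  have hν : ∀ a b, (fun y ↦ ρ a b (F.Φ y) - F.ε * Real.exp (F.psi Ψt y) * gramInv g K y a b) =
      fun y ↦ ρ a b (F.Φ y) + (-F.ε) * (Real.exp (F.psi Ψt y) * gramInv g K y a b) := by
    intro a b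
    funext y
    ring
  have hΨn : ∀ x ∈ U, F.normalD Ψt x =
      2 * (F.chi K x - F.normalD (fun y ↦ Real.log (F.lapse y)) x) := by
    intro x hx
    have hl := (F.lapse_pos x).ne'
    rw [F.normalD_comp_Φ (hp' x hx)]
    field_simp
    linear_combination (F.chi K x - F.normalD (fun y ↦ Real.log (F.lapse y)) x) *
      (F.ε * F.ε * F.σ_mul_self + F.ε_mul_self)
  -- `ν` is forced by the algebraic equation for `γ`; the integrand of `ρ` was chosen so that the
  -- normal derivative of this difference vanishes.
  refine ⟨Ψt, fun x ↦ q (F.Φ x), fun x ↦ Matrix.of fun a b ↦ ρ a b (F.Φ x),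
    fun x ↦ Matrix.of fun a b ↦ ρ a b (F.Φ x) -
      F.ε * Real.exp (F.psi Ψt x) * gramInv g K x a b, ?_⟩
  refine
    { smooth_Ψt := fun x hx ↦ (hΨ x hx).contMDiffWithinAt
      smooth_α := fun x hx ↦ (F.smoothAt_comp_Φ (hq x hx)).contMDiffWithinAt
      smooth_γ := fun a b x hx ↦ (hγ a b x hx).contMDiffWithinAt
      smooth_ν := fun a b x hx ↦ ?_
      normalD_Ψt := hΨn
      tanD_Ψt := fun x hx v ↦ F.tanD_comp_Φ (hp' x hx) v
      normalD_α := fun x hx ↦ ?_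
      tanD_α := fun x hx v ↦ F.tanD_comp_Φ (hq' x hx) v
      γ_eq := fun x hx a b ↦ by simp
      γ_symm := fun x hx ↦ ?_
      normalD_ν := fun a b x hx ↦ ?_
      tanD_γ := fun a b x hx v ↦ F.tanD_comp_Φ (hρ' a b x hx) v }
  · simp only [Matrix.of_apply]
    rw [hν a b]
    exact ((hγ a b x hx).add (hεE a b x hx)).contMDiffWithinAt
  · have hl := (F.lapse_pos x).ne'
    rw [F.normalD_comp_Φ (hq' x hx), exp_psi]
    field_simp
    linear_combination (-F.ε * F.chi K x * Real.exp (p (F.Φ x))) * F.σ_mul_self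
  · ext a b
    simp [ρ, add_comm]
  · have hl := (F.lapse_pos x).ne'
    have hΨx := F.smoothAt_psi (hΨ x hx)
    have h5 := hΨn x hx
    have h6 := F.normalD_comp_Φ (hρ' a b x hx)
    simp only [Matrix.of_apply]
    rw [hν a b]
    simp only [normalD] at h5 h6 ⊢
    rw [(hγ a b x hx).mvfderiv_add (hεE a b x hx),
      SmoothAt.mvfderiv_const_mul _ (hΨx.exp.fun_mul (hGs x a b)),
      hΨx.exp.mvfderiv_mul (hGs x a b), hΨx.mvfderiv_exp, F.mvfderiv_psi (hΨ x hx), h5, h6,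
      exp_psi]
    field_simp
    linear_combination F.lapse x ^ 2 * Real.exp (Ψt x) * F.ε * (2 * F.chi K x * gramInv g K x a b +
      mvfderiv (𝓡 m) (fun z ↦ gramInv g K z a b) x (F.normal x)) * F.σ_mul_self

/-- In straightened coordinates a slice of the ball is its intersection with a level set of a linear
form, which is convex. -/
theorem exists_isPreconnected_slices (x : M) :
    ∃ U : Set M, IsOpen U ∧ x ∈ U ∧ ∀ s, IsPreconnected (U ∩ F.slice s) := by
  obtain ⟨q, ℓ, v, δ, hδ, -, hq0, -, hq, hΦ, ho, -⟩ := exists_straightening (F.smoothAt_Φ x)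
    (F.exists_mvfderiv_ne_zero x) Filter.univ_mem
  refine ⟨_, ho, ⟨0, Metric.mem_ball_self hδ, hq0⟩, fun s ↦ ?_⟩
  have e : q '' Metric.ball 0 δ ∩ F.slice s =
      q '' (Metric.ball 0 δ ∩ ℓ ⁻¹' {s - F.Φ x}) := by
    ext y
    constructor
    · rintro ⟨⟨z, hz, rfl⟩, hy⟩
      refine ⟨z, ⟨hz, ?_⟩, rfl⟩
      have h1 := hΦ z hz
      have h2 : F.Φ (q z) = s := hy
      simp only [mem_preimage, mem_singleton_iff]
      linarith
    · rintro ⟨z, ⟨hz, hzs⟩, rfl⟩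
      refine ⟨⟨z, hz, rfl⟩, ?_⟩
      have h1 := hΦ z hz
      simp only [mem_preimage, mem_singleton_iff] at hzs
      change F.Φ (q z) = s
      linarith
  rw [e]
  refine IsPreconnected.image ?_ q fun z hz ↦
    (hq z hz.1).continuousAt.continuousWithinAt
  exact ((convex_ball 0 δ).inter
    ((convex_singleton (s - F.Φ x)).linear_preimage ℓ.toLinearMap)).isPreconnected

end Foliation

end SliceKT

end

/-! ### The three conclusions -/

theorem mainTheorem2 {m n : ℕ} (hn : n + 2 ≤ m)
    {M : Type*} [TopologicalSpace M] [T2Space M] [SecondCountableTopology M]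
    [ChartedSpace (EuclideanSpace ℝ (Fin m)) M] [IsManifold (𝓡 m) ∞ M]
    (g : SliceKT.LorentzianMetric m M) (F : SliceKT.Foliation g)
    (K : Fin n → (y : M) → TangentSpace (𝓡 m) y)
    -- the Killing vector fields are tangent to the slices, with a non-degenerate Gram matrix
    (hK : ∀ a, SliceKT.IsKillingField g (K a))
    (hKtan : ∀ a x, g x (F.normal x) (K a x) = 0)
    (hG : ∀ x, IsUnit (SliceKT.gram g K x).det)
    -- the second fundamental form is block diagonal and partially umbilic
    (hblock : ∀ x a X, F.IsComplementary K x X → F.secondForm x (K a x) X = 0)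
    (humb : ∀ x X Y, F.IsComplementary K x X → F.IsComplementary K x Y →
      F.secondForm x X Y = F.chi K x * g x X Y)
    -- integrability conditions
    (h1 : ∀ x v, F.tanD (fun y ↦ F.lapse y * F.chi K y
      - F.lapse y * F.normalD (fun z ↦ Real.log (F.lapse z)) y) x v = 0)
    (h2 : ∀ x v, F.tanD (fun y ↦ F.chi K y * F.lapse y ^ 3) x v = 0)
    (h3 : ∀ x, F.chi K x ≠ 0 → ∀ a b v,
      F.tanD (fun y ↦ SliceKT.gramInv g K y a b + 1 / (2 * F.chi K y) *
        F.normalD (fun z ↦ SliceKT.gramInv g K z a b) y) x v = 0)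
    -- its replacement at the points where `χ` vanishes
    (h3' : ∀ x, F.chi K x = 0 → ∀ a b v,
      F.tanD (fun y ↦ F.normalD (fun z ↦ SliceKT.gramInv g K z a b) y) x v =
        - F.tanD (fun y ↦ Real.log (F.lapse y ^ 3)) x v *
          F.normalD (fun z ↦ SliceKT.gramInv g K z a b) x) :
    -- every solution of the equations gives a slice-reducible Killing tensor
    (∀ U : Set M, IsOpen U → ∀ (Ψt α : M → ℝ) (γ ν : M → Matrix (Fin n) (Fin n) ℝ),
      F.IsSolutionOn K U Ψt α γ ν →
        SliceKT.IsKillingTensorOn g U (F.liftedTensor K Ψt α γ) ∧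
        F.IsSliceReducibleOn U (F.liftedTensor K Ψt α γ)) ∧
    -- the equations are solvable on `M` if the slices are connected, and more generally
    -- on every open set with connected slices
    (∀ U : Set M, IsOpen U → (∀ s, IsPreconnected (U ∩ F.slice s)) →
      ∃ (Ψt α : M → ℝ) (γ ν : M → Matrix (Fin n) (Fin n) ℝ), F.IsSolutionOn K U Ψt α γ ν) ∧
    -- the equations are always solvable near every point
    (∀ x₀ : M, ∃ U : Set M, IsOpen U ∧ x₀ ∈ U ∧
      ∃ (Ψt α : M → ℝ) (γ ν : M → Matrix (Fin n) (Fin n) ℝ), F.IsSolutionOn K U Ψt α γ ν) := by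
  refine ⟨fun U hU Ψt α γ ν hsol ↦
      ⟨F.isKillingTensorOn_liftedTensor hK hKtan hG hblock humb hU hsol,
        F.isSliceReducibleOn_liftedTensor hK hKtan hsol⟩,
    fun U hU hs ↦ F.exists_isSolutionOn hn hK hKtan hG humb h1 h2 h3 h3' hU hs, fun x₀ ↦ ?_⟩
  obtain ⟨U, hU, hx, hs⟩ := F.exists_isPreconnected_slices x₀
  exact ⟨U, hU, hx, F.exists_isSolutionOn hn hK hKtan hG humb h1 h2 h3 h3' hU hs⟩
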